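/- Let $N \ge 2$, let $1 \le a, b \le N-1$ with $\gcd(N,a)=1$, and let $\lambda \in \mathbb{C} \setminus \{0,1\}$. Let $C^{a,b}_{N,\lambda}$ be the smooth projective curve over $\mathbb{C}$ defined in affine coordinates by $$v^N = (-u)^a (1-u)^{N-a} (1-\lambda u)^{N-b},$$ that is, the smooth projective curve whose function field is the fraction field of the coordinate ring of this (integral) affine curve. Then $C^{a,b}_{N,\lambda}$ admits a morphism of degree $2$ to $\mathbb{P}^1$ if and only if 1. $a=b$ or $a+b=N$, or 2. $N=2m$ and $b=m$ for some integer $m$. If moreover $N \ge 3$, then $C^{a,b}_{N,\lambda}$ is hyperelliptic (that is, it has genus at least $2$ and admits a morphism of degree $2$ to $\mathbb{P}^1$) if and only if (1) or (2) holds. -/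

import Mathlib

open Polynomial
open scoped IntermediateField KaehlerDifferential

noncomputable section

namespace HypergeometricQuotient

/-! ## Smooth projective curves over `ℂ` through their function fields

A smooth projective curve over `ℂ` is determined by its function field `K`: its closed points are
the valuation rings of `K` over `ℂ` other than `K` itself, the local ring at a point is
that valuation ring, and its finite morphisms to the projective line are the non-constant elements
of `K`. In this section `K` is the function field of the curve. -/

section Curve

variable (K : Type) [Field K] [Algebra ℂ K]

/-- The closed points of the smooth projective curve with function field `K`: the valuation rings
`ℂ ⊆ O ⊊ K`. The ring `O` is the local ring of the curve at the point. -/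
structure ClosedPoint where
  localRing : ValuationSubring K
  algebraMap_mem : ∀ c : ℂ, algebraMap ℂ K c ∈ localRing
  ne_top : localRing ≠ ⊤

/-- The rational differentials that are regular at the point `P`, with local ring `O`: the
`O`-submodule of `Ω[K⁄ℂ]` generated by the `df` with `f ∈ O`, in other words the image of
`Ω[O⁄ℂ]`. -/
def differentialsRegularAt (P : ClosedPoint K) : Submodule P.localRing (Ω[K⁄ℂ]) :=
  Submodule.span P.localRing {ω | ∃ f ∈ P.localRing, ω = KaehlerDifferential.D ℂ K f}

/-- The space of global regular differentials of the curve. -/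
def regularDifferentials : Submodule ℂ (Ω[K⁄ℂ]) where
  carrier := {ω | ∀ P : ClosedPoint K, ω ∈ differentialsRegularAt K P}
  zero_mem' P := Submodule.zero_mem _
  add_mem' h₁ h₂ P := Submodule.add_mem _ (h₁ P) (h₂ P)
  smul_mem' c ω h P := by
    have h' := Submodule.smul_mem _ (⟨algebraMap ℂ K c, P.algebraMap_mem c⟩ : P.localRing) (h P)
    have e : (⟨algebraMap ℂ K c, P.algebraMap_mem c⟩ : P.localRing) • ω = c • ω :=
      algebraMap_smul K c ω
    rwa [e] at h'

/-- The genus of the curve: the dimension of its space of regular differentials. -/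
def genus : Cardinal := Module.rank ℂ (regularDifferentials K)

/-- The curve has a morphism of degree two to the projective line. Such a morphism is a
non-constant rational function `x`, and its degree is the degree of the function field over the
subfield `ℂ(x)`, the function field of the projective line. -/
def HasDegreeTwoMapToP1 : Prop :=
  ∃ x : K, Transcendental ℂ x ∧ Module.finrank ℂ⟮x⟯ K = 2

/-- A curve is hyperelliptic if its genus is at least two and it has a morphism of degree two
to the projective line. -/
def IsHyperelliptic : Prop :=
  2 ≤ genus K ∧ HasDegreeTwoMapToP1 K

end Curve

/-! ## The quotient curves -/

/-- The parameters of a quotient curve. -/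
structure QuotientCurve where
  N : ℕ
  a : ℕ
  b : ℕ
  lam : ℂ
  one_le_a : 1 ≤ a
  a_le : a ≤ N - 1
  one_le_b : 1 ≤ b
  b_le : b ≤ N - 1
  gcd_eq_one : Nat.gcd N a = 1
  lam_ne_zero : lam ≠ 0
  lam_ne_one : lam ≠ 1

namespace QuotientCurve

variable (Q : QuotientCurve)

/-- The polynomial `(-u)^a (1 - u)^(N - a) (1 - λ u)^(N - b)` in `u`. -/
def rhs : ℂ[X] :=
  (-X) ^ Q.a * (1 - X) ^ (Q.N - Q.a) * (1 - C Q.lam * X) ^ (Q.N - Q.b)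

/-- The polynomial `v^N - (-u)^a (1 - u)^(N - a) (1 - λ u)^(N - b)`; the outer variable is `v`
and the inner one is `u`. -/
def polynomial : ℂ[X][X] := X ^ Q.N - C Q.rhs

/-- The coordinate ring of the affine curve
`v^N = (-u)^a (1 - u)^(N - a) (1 - λ u)^(N - b)`. -/
abbrev CoordinateRing : Type := AdjoinRoot Q.polynomial

/-- The function field of the affine curve, and so of its smooth projective model. -/
abbrev FunctionField : Type := FractionRing Q.CoordinateRing

lemma N_pos : 0 < Q.N := by
  have := Q.one_le_a
  have := Q.a_le
  omega

lemma rhs_ne_zero : Q.rhs ≠ 0 := by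
  have h1 : (1 - X : ℂ[X]) ≠ 0 := fun h => by simpa using congrArg (eval 0) h
  have h2 : (1 - C Q.lam * X : ℂ[X]) ≠ 0 := fun h => by simpa using congrArg (eval 0) h
  exact mul_ne_zero (mul_ne_zero (pow_ne_zero _ (neg_ne_zero.2 X_ne_zero)) (pow_ne_zero _ h1))
    (pow_ne_zero _ h2)

lemma rootMultiplicity_zero_pow (p : ℂ[X]) (n : ℕ) :
    rootMultiplicity 0 (p ^ n) = n * rootMultiplicity 0 p := by
  rw [← count_roots, ← count_roots, roots_pow, Multiset.count_nsmul]

lemma rootMultiplicity_rhs : rootMultiplicity 0 Q.rhs = Q.a := by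
  have e : Q.rhs = (X - C 0) ^ Q.a *
      ((-1) ^ Q.a * (1 - X) ^ (Q.N - Q.a) * (1 - C Q.lam * X) ^ (Q.N - Q.b)) := by
    rw [rhs, neg_pow]; simp; ring
  have h0 := Q.rhs_ne_zero
  rw [e] at h0 ⊢
  rw [rootMultiplicity_mul h0, rootMultiplicity_X_sub_C_pow, rootMultiplicity_eq_zero]
  · simp
  · simp [IsRoot]

lemma monic_polynomial : Q.polynomial.Monic :=
  monic_X_pow_sub_C _ Q.N_pos.ne'

lemma irreducible_map :
    Irreducible (X ^ Q.N - C (algebraMap ℂ[X] (FractionRing ℂ[X]) Q.rhs)) := by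
  set F := FractionRing ℂ[X]
  set f : F := algebraMap ℂ[X] F Q.rhs
  have hN := Q.N_pos
  have hu : ¬ IsUnit (X ^ Q.N - C f) := by
    rw [Polynomial.isUnit_iff_degree_eq_zero, degree_X_pow_sub_C hN, Nat.cast_eq_zero]
    exact hN.ne'
  have ⟨g, hg, hg'⟩ := WfDvdMonoid.exists_irreducible_factor hu (X_pow_sub_C_ne_zero hN f)
  have hle : natDegree g ≤ Q.N := by
    simpa using natDegree_le_of_dvd hg' (X_pow_sub_C_ne_zero hN f)
  have hpos : 0 < natDegree g := hg.natDegree_pos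
  suffices hd : Q.N ∣ natDegree g by
    have h' : natDegree g = Q.N := le_antisymm hle (Nat.le_of_dvd hpos hd)
    exact (associated_of_dvd_of_natDegree_le hg' (X_pow_sub_C_ne_zero hN f)
      (by simp [h'])).irreducible hg
  have : Fact (Irreducible g) := ⟨hg⟩
  have key : (Algebra.norm F (AdjoinRoot.root g)) ^ Q.N = f ^ natDegree g := by
    have := AdjoinRoot.eval₂_root g
    have e : (AdjoinRoot.root g) ^ Q.N = algebraMap F _ f := by
      have h := eval₂_eq_zero_of_dvd_of_eval₂_eq_zero (AdjoinRoot.of g) (AdjoinRoot.root g) hg' this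
      simpa [sub_eq_zero] using h
    rw [← map_pow, e, Algebra.norm_algebraMap, (AdjoinRoot.powerBasis hg.ne_zero).finrank,
      AdjoinRoot.powerBasis_dim]
  obtain ⟨r, s, hs, hrs⟩ := IsFractionRing.div_surjective (A := ℂ[X])
    (Algebra.norm F (AdjoinRoot.root g))
  have hs0 : s ≠ 0 := nonZeroDivisors.ne_zero hs
  have hs1 : algebraMap ℂ[X] F s ≠ 0 := by simpa using hs0
  rw [← hrs, div_pow, div_eq_iff (pow_ne_zero _ hs1), ← map_pow, ← map_pow, ← map_pow,
    ← map_mul] at key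
  have key' : r ^ Q.N = Q.rhs ^ natDegree g * s ^ Q.N := IsFractionRing.injective ℂ[X] F key
  have hne : Q.rhs ^ natDegree g * s ^ Q.N ≠ 0 :=
    mul_ne_zero (pow_ne_zero _ Q.rhs_ne_zero) (pow_ne_zero _ hs0)
  have hr0 : r ≠ 0 := by
    rintro rfl
    rw [zero_pow hN.ne'] at key'
    exact hne key'.symm
  have hm := congrArg (rootMultiplicity 0) key'
  rw [rootMultiplicity_mul hne, rootMultiplicity_zero_pow _, rootMultiplicity_zero_pow _,
    rootMultiplicity_zero_pow _, rootMultiplicity_rhs] at hm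
  have hdvd : Q.N ∣ natDegree g * Q.a :=
    (Nat.dvd_add_left (dvd_mul_right _ _)).1 (hm ▸ dvd_mul_right _ _)
  exact (Nat.Coprime.dvd_of_dvd_mul_right (show Nat.Coprime Q.N Q.a from Q.gcd_eq_one) hdvd)

lemma irreducible_polynomial : Irreducible Q.polynomial := by
  rw [Q.monic_polynomial.irreducible_iff_irreducible_map_fraction_map (K := FractionRing ℂ[X])]
  simpa [polynomial] using Q.irreducible_map

/-- The affine curve is integral, so that it has a function field. -/
instance : IsDomain Q.CoordinateRing :=
  AdjoinRoot.isDomain_of_prime Q.irreducible_polynomial.prime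

end QuotientCurve

end HypergeometricQuotient

end

/-! In the coordinates z = -u/(1-u), V = v/((1-u)(1-λu)) the curve reads V^N = z^a ((1-z)/(1-μz))^b
with μ = 1-λ. Let ka ≡ 1 and kb ≡ c mod N with 0 < c < N. A monomial in V^k, z and s = (1-μz)/(1-z)
then gives a generator y with y^N = z s^(-c). Replacing y by ys turns the exponent -c into N-c;
rescaling z by μ exchanges 1-z and 1-μz and turns it into c. So the normal form y^N = z
((1-μz)/(1-z))^c (`IsCyclicCover`) may be assumed to have 2c ≤ N (`exists_isCyclicCover`), and the
claim becomes: a degree two map exists iff c = 1 or 2c = N.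

If c = 1, the relation is quadratic in z over ℂ(y). If 2c = N, then t = y²(1-z)/(1-μz) satisfies t^c
= z, and y² lies in ℂ(t).

For the other direction, a regular differential on a double cover of ℙ¹ is anti-invariant, because
ℙ¹ has no regular differentials (`IsDoubleCover.even_part_eq_zero`). Quotients of regular
differentials therefore lie in ℂ(x), a proper subfield (`IsDoubleCover.div_mem_adjoin`). When 2 ≤ c
and 2c < N, three eigendifferentials y^j (1-z)^k (1-μz)^(-k-1) dz/z, regular by
`eigenDifferential_mem`, have quotients that generate all of K (`not_hasDegreeTwoMapToP1`).

For N ≥ 3 two independent eigendifferentials show that the genus is at least 2 (`two_le_genus`), so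
the hyperelliptic criterion adds no condition. -/

noncomputable section

namespace HypergeometricQuotient

/-! ### Closed points as discrete valuations, and logarithmic differentials -/

section Valuation

variable {K : Type} [Field K] [Algebra ℂ K]

-- The integral closure B of ℂ[z] in K is Dedekind and lies in the integrally closed ring O. The
-- maximal ideal of O contracts to a nonzero prime of B, whose discrete valuation ring lies in O; it
-- must equal O, since O ≠ K and a discrete valuation ring is a maximal proper subring of its field.
open scoped IntermediateField.algebraAdjoinAdjoin in
lemma ClosedPoint.exists_valuation_of_mem {z : K} [FiniteDimensional ℂ⟮z⟯ K] (P : ClosedPoint K)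
    (hz : z ∈ P.localRing) :
    ∃ w : Valuation K (WithZero (Multiplicative ℤ)),
      (∃ t, w t = WithZero.exp (-1)) ∧ w.valuationSubring = P.localRing := by
  set O := P.localRing
  let A := Algebra.adjoin ℂ {z}
  have : IsPrincipalIdealRing A := by
    have hs : Function.Surjective (AlgHom.rangeRestrict (aeval z : ℂ[X] →ₐ[ℂ] K)) :=
      AlgHom.rangeRestrict_surjective _
    have h : (aeval z : ℂ[X] →ₐ[ℂ] K).range = A :=
      (Algebra.adjoin_singleton_eq_range_aeval ℂ z).symm
    rw [← h]
    exact IsPrincipalIdealRing.of_surjective _ hs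
  have hAO : ∀ x ∈ A, x ∈ O := fun x hx =>
    Algebra.adjoin_induction (by rintro x rfl; exact hz) P.algebraMap_mem
      (fun _ _ _ _ => add_mem) (fun _ _ _ _ => mul_mem) hx
  let B := integralClosure A K
  have : IsDedekindDomain B := integralClosure.isDedekindDomain A ℂ⟮z⟯ K
  have : IsFractionRing B K := integralClosure.isFractionRing_of_finite_extension ℂ⟮z⟯ K
  let f : A →+* O := (algebraMap A K).codRestrict O.toSubring (fun x => hAO x x.2)
  let _ := f.toAlgebra
  have : IsScalarTower A O K := IsScalarTower.of_algebraMap_eq fun _ => rfl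
  have hBO : ∀ x : B, (x : K) ∈ O := fun x => by
    have h : IsIntegral O (x : K) := IsIntegral.tower_top x.2
    obtain ⟨y, hy⟩ := IsIntegrallyClosed.isIntegral_iff.1 h
    exact hy ▸ y.2
  let g : B →+* O := (algebraMap B K).codRestrict O.toSubring hBO
  let p : Ideal B := (IsLocalRing.maximalIdeal O).comap g
  have hunit : ∀ b : B, b ∉ p → (b : K)⁻¹ ∈ O := fun b hb => by
    have hu : IsUnit (g b) := by
      by_contra hu
      exact hb ((IsLocalRing.mem_maximalIdeal _).2 hu)
    obtain ⟨c, hc⟩ := hu.exists_right_inv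
    have : (b : K) * c = 1 := congrArg Subtype.val hc
    rw [inv_eq_of_mul_eq_one_right this]
    exact c.2
  have hp : p ≠ ⊥ := fun hp => P.ne_top <| by
    refine eq_top_iff.2 fun x _ => ?_
    obtain ⟨r, s, hs, rfl⟩ := IsFractionRing.div_surjective (A := B) x
    rw [div_eq_mul_inv]
    refine mul_mem (hBO r) (hunit s fun h => ?_)
    rw [hp] at h
    exact nonZeroDivisors.ne_zero hs h
  let v : IsDedekindDomain.HeightOneSpectrum B := ⟨p, inferInstance, hp⟩
  refine ⟨v.valuation K, v.valuation_exists_uniformizer K, ?_⟩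
  rw [← v.valuationSubringAtPrime_eq_valuationSubring]
  refine ValuationSubring.eq_of_le_of_ne_top _ ?_ P.ne_top
  rw [v.valuationSubringAtPrime_eq_valuationSubring]
  intro x hx
  obtain ⟨n, d, h⟩ := v.exists_primeCompl_mul_eq_of_integer x hx
  have hd : (d : B) ≠ 0 := fun h => d.2 (h ▸ p.zero_mem)
  have hd' : algebraMap B K d ≠ 0 := by simpa using hd
  rw [← eq_div_iff hd', div_eq_mul_inv] at h
  rw [h]
  exact mul_mem (hBO n) (hunit d d.2)

lemma ClosedPoint.exists_valuation {z : K} [FiniteDimensional ℂ⟮z⟯ K] (P : ClosedPoint K) :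
    ∃ w : Valuation K (WithZero (Multiplicative ℤ)),
      (∃ t, w t = WithZero.exp (-1)) ∧ w.valuationSubring = P.localRing := by
  rcases P.localRing.mem_or_inv_mem z with h | h
  · exact P.exists_valuation_of_mem h
  · have e : ℂ⟮z⁻¹⟯ = ℂ⟮z⟯ := by
      apply le_antisymm
      · exact IntermediateField.adjoin_simple_le_iff.2
          (inv_mem (IntermediateField.mem_adjoin_simple_self ℂ z))
      · refine IntermediateField.adjoin_simple_le_iff.2 ?_
        simpa using inv_mem (IntermediateField.mem_adjoin_simple_self ℂ z⁻¹)
    have : FiniteDimensional ℂ⟮z⁻¹⟯ K := by rw [e]; infer_instance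
    exact P.exists_valuation_of_mem h

lemma ClosedPoint.smul_mem_differentialsRegularAt {P : ClosedPoint K} {g : K} {ω : Ω[K⁄ℂ]}
    (hg : g ∈ P.localRing) (hω : ω ∈ differentialsRegularAt K P) :
    g • ω ∈ differentialsRegularAt K P :=
  Submodule.smul_mem _ (⟨g, hg⟩ : P.localRing) hω

lemma ClosedPoint.D_mem_differentialsRegularAt {P : ClosedPoint K} {f : K}
    (hf : f ∈ P.localRing) : KaehlerDifferential.D ℂ K f ∈ differentialsRegularAt K P :=
  Submodule.subset_span ⟨f, hf, rfl⟩

/-- A logarithmic differential `df / f` has at most a simple pole. -/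
lemma ClosedPoint.smul_D_mem_differentialsRegularAt {P : ClosedPoint K}
    {w : Valuation K (WithZero (Multiplicative ℤ))} {t : K} (ht : w t = WithZero.exp (-1))
    (hw : w.valuationSubring = P.localRing) {f g : K} (hf : f ≠ 0) (hg : w g < 1) :
    (g / f) • KaehlerDifferential.D ℂ K f ∈ differentialsRegularAt K P := by
  have hmem : ∀ x, x ∈ P.localRing ↔ w x ≤ 1 := fun x => by rw [← hw]; rfl
  have ht0 : t ≠ 0 := by
    rintro rfl
    exact WithZero.exp_ne_zero (ht.symm.trans (map_zero w))
  obtain ⟨n, hn⟩ : ∃ n : ℤ, w f = w t ^ n := by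
    refine ⟨-(WithZero.log (w f)), ?_⟩
    rw [ht, ← WithZero.exp_zsmul]
    simp [hf]
  set ε := f / t ^ n with hε
  have htn : t ^ n ≠ 0 := zpow_ne_zero _ ht0
  have hfe : f = ε * t ^ n := by rw [hε, div_mul_cancel₀ _ htn]
  have hwε : w ε = 1 := by
    rw [hε, map_div₀, map_zpow₀, hn, div_self]
    rw [← map_zpow₀]; exact (map_ne_zero w).2 htn
  have hε0 : ε ≠ 0 := div_ne_zero hf htn
  -- With f = ε t^n and ε a unit, df/f = dε/ε + n dt/t. The zero of g cancels the only possible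
  -- pole, that of dt/t.
  have key : (g / f) • KaehlerDifferential.D ℂ K f =
      (g / ε) • KaehlerDifferential.D ℂ K ε + (n * (g / t)) • KaehlerDifferential.D ℂ K t := by
    rw [hfe, Derivation.leibniz, Derivation.leibniz_zpow, smul_add, smul_smul, smul_smul, add_comm,
      smul_comm n, ← Int.cast_smul_eq_zsmul K n, smul_smul, smul_smul, zpow_sub_one₀ ht0]
    congr 2
    · field_simp
    · field_simp
  rw [key]
  refine add_mem (smul_mem_differentialsRegularAt ?_ (D_mem_differentialsRegularAt ?_))
    (smul_mem_differentialsRegularAt ?_ (D_mem_differentialsRegularAt ?_))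
  · rw [hmem, map_div₀, hwε, div_one]; exact hg.le
  · rw [hmem, hwε]
  · refine mul_mem (intCast_mem _ n) ((hmem _).2 ?_)
    rw [map_div₀, ht]
    by_cases h : g = 0
    · simp [h]
    have hg' : w g ≠ 0 := by simpa using h
    rw [div_le_one₀ (by simp)]
    rw [← WithZero.exp_log hg'] at hg ⊢
    rw [← WithZero.exp_zero, WithZero.exp_lt_exp] at hg
    rw [WithZero.exp_le_exp]
    omega
  · rw [hmem, ht, ← WithZero.exp_zero, WithZero.exp_le_exp]; norm_num

end Valuation

/-! ### The normal form and its regular eigendifferentials -/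

section CyclicCover

variable {K : Type} [Field K] [Algebra ℂ K]

/-- The field `K` is generated over `ℂ` by a transcendental `z` and an `N`-th root `y` of
`z ((1 - μ z) / (1 - z)) ^ c`. -/
structure IsCyclicCover (N c : ℕ) (μ : ℂ) (z y : K) : Prop where
  transcendental : Transcendental ℂ z
  adjoin_eq_top : IntermediateField.adjoin ℂ {z, y} = ⊤
  pow_mul_eq : y ^ N * (1 - z) ^ c = z * (1 - algebraMap ℂ K μ * z) ^ c
  ne_zero : μ ≠ 0
  ne_one : μ ≠ 1
  pos : 0 < c
  lt : c < N

/-- The eigendifferentials `y ^ j (1 - z) ^ k (1 - μ z) ^ (-k - 1) dz / z`. -/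
def eigenDifferential (μ : ℂ) (z y : K) (j k : ℕ) : Ω[K⁄ℂ] :=
  (y ^ j * (1 - z) ^ k / ((1 - algebraMap ℂ K μ * z) ^ (k + 1) * z)) •
    KaehlerDifferential.D ℂ K z

lemma _root_.Transcendental.ne_algebraMap {z : K} (hz : Transcendental ℂ z) (c : ℂ) :
    z ≠ algebraMap ℂ K c := by
  rintro rfl
  exact hz (isAlgebraic_algebraMap c)

lemma _root_.Transcendental.one_sub_mul_ne_zero {z : K} (hz : Transcendental ℂ z) (c : ℂ) :
    1 - algebraMap ℂ K c * z ≠ 0 := by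
  intro h
  rcases eq_or_ne c 0 with rfl | hc
  · simp at h
  · refine hz.ne_algebraMap c⁻¹ ?_
    have hc' : algebraMap ℂ K c ≠ 0 := by simpa using hc
    rw [map_inv₀]
    exact eq_inv_of_mul_eq_one_right (by linear_combination -h)

lemma _root_.Transcendental.one_sub_ne_zero {z : K} (hz : Transcendental ℂ z) : 1 - z ≠ 0 := by
  simpa using hz.one_sub_mul_ne_zero 1

namespace IsCyclicCover

variable {N c : ℕ} {μ : ℂ} {z y : K}

lemma z_ne_zero (h : IsCyclicCover N c μ z y) : z ≠ 0 := by
  simpa using h.transcendental.ne_algebraMap 0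

lemma y_ne_zero (h : IsCyclicCover N c μ z y) : y ≠ 0 := by
  rintro rfl
  have := h.pow_mul_eq
  rw [zero_pow (h.pos.trans h.lt).ne', zero_mul] at this
  exact mul_ne_zero h.z_ne_zero (pow_ne_zero _ (h.transcendental.one_sub_mul_ne_zero μ)) this.symm

lemma finiteDimensional (h : IsCyclicCover N c μ z y) : FiniteDimensional ℂ⟮z⟯ K := by
  have e : (IntermediateField.adjoin ℂ⟮z⟯ {y}) = ⊤ := by
    have h1 := IntermediateField.adjoin_adjoin_left ℂ {z} {y}
    rw [Set.singleton_union, h.adjoin_eq_top] at h1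
    rw [← IntermediateField.restrictScalars_eq_top_iff (K := ℂ)]
    exact h1
  have hz : z ∈ ℂ⟮z⟯ := IntermediateField.mem_adjoin_simple_self ℂ z
  have hq := h.transcendental.one_sub_ne_zero
  let r : ℂ⟮z⟯ := ⟨z * (1 - algebraMap ℂ K μ * z) ^ c / (1 - z) ^ c,
    div_mem (mul_mem hz (pow_mem (sub_mem (one_mem _)
      (mul_mem (IntermediateField.algebraMap_mem _ _) hz)) _))
      (pow_mem (sub_mem (one_mem _) hz) _)⟩
  have hy : IsIntegral ℂ⟮z⟯ y := by
    refine IsIntegral.of_pow (n := N) (h.pos.trans h.lt) ?_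
    have : y ^ N = algebraMap ℂ⟮z⟯ K r := by
      change _ = z * (1 - algebraMap ℂ K μ * z) ^ c / (1 - z) ^ c
      rw [eq_div_iff (pow_ne_zero _ hq), h.pow_mul_eq]
    rw [this]
    exact isIntegral_algebraMap
  have := IntermediateField.adjoin.finiteDimensional hy
  rw [e] at this
  exact Module.Finite.equiv (IntermediateField.topEquiv (F := ℂ⟮z⟯) (E := K)).toLinearEquiv

/-- Over each of the four special values of z the form is a logarithmic differential times a
function, and one inequality makes that function vanish: `hj0` over 0, `hk'` over 1, `hk` over 1/μ,
`hjN` over ∞. Orders of y are compared after raising to the N-th power, so ramification indices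
never enter. -/
theorem eigenDifferential_mem (h : IsCyclicCover N c μ z y) {j k : ℕ} (hj0 : 0 < j) (hjN : j < N)
    (hk : k * N < j * c) (hk' : j * c < (k + 1) * N) :
    eigenDifferential μ z y j k ∈ regularDifferentials K := by
  intro P
  have := h.finiteDimensional
  obtain ⟨w, ⟨t, ht⟩, hw⟩ := P.exists_valuation (z := z)
  have hmem : ∀ x, x ∈ P.localRing ↔ w x ≤ 1 := fun x => by rw [← hw]; rfl
  have hconst : ∀ a : ℂ, a ≠ 0 → w (algebraMap ℂ K a) = 1 := fun a ha => by
    have h1 := (hmem _).1 (P.algebraMap_mem a)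
    have h2 := (hmem _).1 (P.algebraMap_mem a⁻¹)
    refine le_antisymm h1 ?_
    rw [map_inv₀, map_inv₀] at h2
    have h0 : w (algebraMap ℂ K a) ≠ 0 := by simpa using ha
    exact (inv_le_one₀ (zero_lt_iff.2 h0)).1 h2
  have hN0 : N ≠ 0 := (h.pos.trans h.lt).ne'
  have hz0 := h.z_ne_zero
  have hq0 := h.transcendental.one_sub_ne_zero
  have hp0 := h.transcendental.one_sub_mul_ne_zero μ
  have hμ := hconst μ h.ne_zero
  have hμ0 : algebraMap ℂ K μ ≠ 0 := by simpa using h.ne_zero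
  have hμ1 : w (1 - algebraMap ℂ K μ) = 1 := by
    simpa using hconst (1 - μ) (sub_ne_zero.2 h.ne_one.symm)
  have hrel := congrArg w h.pow_mul_eq
  simp only [map_mul, map_pow] at hrel
  unfold eigenDifferential
  set q := 1 - z with hq
  set p := 1 - algebraMap ℂ K μ * z with hp
  have hDq : KaehlerDifferential.D ℂ K q = - KaehlerDifferential.D ℂ K z := by
    rw [hq, map_sub, Derivation.map_one_eq_zero, zero_sub]
  have hDp : KaehlerDifferential.D ℂ K p =
      -(algebraMap ℂ K μ • KaehlerDifferential.D ℂ K z) := by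
    rw [hp, map_sub, Derivation.map_one_eq_zero, zero_sub, Derivation.leibniz,
      Derivation.map_algebraMap, smul_zero, add_zero]
  have hwq0 : 0 < w q := zero_lt_iff.2 (by simpa using hq0)
  have hwp0 : 0 < w p := zero_lt_iff.2 (by simpa using hp0)
  have lt_one_of_pow : ∀ g, w g ^ N < 1 → w g < 1 := fun g hg => (pow_lt_one_iff hN0).1 hg
  rcases lt_trichotomy (w z) 1 with hz | hz | hz
  · -- above `z = 0`
    have hwq : w q = 1 := by
      rw [hq, Valuation.map_sub_eq_of_lt_left _ (by simpa using hz), map_one]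
    have hwp : w p = 1 := by
      rw [hp, Valuation.map_sub_eq_of_lt_left _ (by simpa [hμ] using hz), map_one]
    rw [hwq, hwp, one_pow, mul_one, mul_one] at hrel
    have hwy : w y < 1 := lt_one_of_pow _ (hrel ▸ hz)
    rw [← div_div]
    refine ClosedPoint.smul_D_mem_differentialsRegularAt ht hw hz0 ?_
    simp only [map_div₀, map_mul, map_pow, hwq, hwp, one_pow, mul_one, div_one]
    exact pow_lt_one₀ zero_le hwy hj0.ne'
  · rcases lt_or_ge (w q) 1 with hwq | hwq
    · -- above `z = 1`
      have hwp : w p = 1 := by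
        have : p = (1 - algebraMap ℂ K μ) + algebraMap ℂ K μ * q := by rw [hp, hq]; ring
        rw [this, Valuation.map_add_eq_of_lt_left _ (by simpa [hμ1, hμ] using hwq), hμ1]
      have e : (y ^ j * q ^ k / (p ^ (k + 1) * z)) • KaehlerDifferential.D ℂ K z =
          ((-(y ^ j * q ^ (k + 1) / (p ^ (k + 1) * z))) / q) • KaehlerDifferential.D ℂ K q := by
        rw [hDq, smul_neg, ← neg_smul]
        congr 1
        field_simp
        ring
      rw [e]
      refine ClosedPoint.smul_D_mem_differentialsRegularAt ht hw hq0 (lt_one_of_pow _ ?_)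
      simp only [Valuation.map_neg, map_div₀, map_mul, map_pow, hwp, hz, one_pow, mul_one, div_one]
      rw [hwp, hz, one_pow, mul_one] at hrel
      -- Over z = 1 the relation reduces to w(y)^N w(q)^c = 1, which eliminates y.
      have h1 : (w y ^ j * w q ^ (k + 1)) ^ N * w q ^ (j * c) = w q ^ ((k + 1) * N) := by
        calc _ = (w y ^ N * w q ^ c) ^ j * w q ^ ((k + 1) * N) := by
                simp only [mul_pow, ← pow_mul]
                rw [mul_comm N j, mul_comm c j, mul_right_comm]
          _ = _ := by rw [hrel, one_pow, one_mul]
      by_contra! hge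
      have h2 : w q ^ (j * c) ≤ w q ^ ((k + 1) * N) := by
        rw [← h1]; exact le_mul_of_one_le_left' hge
      exact absurd (pow_lt_pow_right_of_lt_one₀ hwq0 hwq hk') (not_lt.2 h2)
    · have hwq1 : w q = 1 := le_antisymm
        ((w.map_sub _ _).trans (by simp [hz])) hwq
      rcases lt_or_ge (w p) 1 with hwp | hwp
      · -- above `z = 1 / μ`
        have e : (y ^ j * q ^ k / (p ^ (k + 1) * z)) • KaehlerDifferential.D ℂ K z =
            ((-(y ^ j * q ^ k / (p ^ k * z * algebraMap ℂ K μ))) / p) •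
              KaehlerDifferential.D ℂ K p := by
          rw [hDp, smul_neg, ← neg_smul, smul_smul]
          congr 1
          field_simp
          ring
        rw [e]
        refine ClosedPoint.smul_D_mem_differentialsRegularAt ht hw hp0 (lt_one_of_pow _ ?_)
        simp only [Valuation.map_neg, map_div₀, map_mul, map_pow, hwq1, hz, hμ, one_pow, mul_one]
        rw [hwq1, hz, one_pow, mul_one, one_mul] at hrel
        rw [div_pow, div_lt_one₀ (pow_pos (pow_pos hwp0 _) _), ← pow_mul, ← pow_mul, mul_comm j,
          pow_mul, hrel, ← pow_mul, mul_comm c]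
        exact pow_lt_pow_right_of_lt_one₀ hwp0 hwp hk
      · have hwp1 : w p = 1 := le_antisymm
          ((w.map_sub _ _).trans (by simp [hz, hμ])) hwp
        rw [hwq1, hwp1, hz, one_pow, mul_one, mul_one] at hrel
        have hwy : w y ≤ 1 := (pow_le_one_iff hN0).1 hrel.le
        refine ClosedPoint.smul_mem_differentialsRegularAt ?_
          (ClosedPoint.D_mem_differentialsRegularAt ?_)
        · rw [hmem]
          simp only [map_div₀, map_mul, map_pow, hwq1, hwp1, hz, one_pow, mul_one, div_one]
          exact pow_le_one₀ zero_le hwy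
        · rw [hmem, hz]
  · -- above `z = ∞`
    have hwq : w q = w z := by
      rw [hq, Valuation.map_sub_eq_of_lt_right _ (by simpa using hz)]
    have hwp : w p = w z := by
      rw [hp, Valuation.map_sub_eq_of_lt_right _ (by simpa [hμ] using hz), map_mul, hμ, one_mul]
    have hwz0 : 0 < w z := zero_lt_one.trans hz
    rw [hwq, hwp] at hrel
    -- At infinity 1-z and 1-μz have the same order as z, which leaves w(y)^N = w(z).
    have hrel' := mul_right_cancel₀ (pow_pos hwz0 c).ne' hrel
    have hwy : 1 < w y := by
      by_contra! hle
      exact absurd (hrel' ▸ pow_le_one₀ zero_le hle) (not_le.2 hz)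
    rw [← div_div]
    refine ClosedPoint.smul_D_mem_differentialsRegularAt ht hw hz0 ?_
    simp only [map_div₀, map_mul, map_pow, hwq, hwp]
    rw [div_lt_one₀ (pow_pos hwz0 _), pow_succ' (w z) k]
    refine mul_lt_mul_of_pos_right ?_ (pow_pos hwz0 _)
    rw [← hrel']
    exact pow_lt_pow_right₀ hwy hjN

end IsCyclicCover
end CyclicCover

/-! ### The derivation T d/dT and square roots in ℂ((T)) -/

section Laurent

/-- The coefficientwise algebra structure, whose scalar action is definitionally the one of
`HahnSeries`. -/
instance laurentAlgebra : Algebra ℂ (LaurentSeries ℂ) := HahnSeries.instAlgebra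

/-- The Laurent series `T df/dT`. -/
def eulerSeries (f : LaurentSeries ℂ) : LaurentSeries ℂ where
  coeff n := (n : ℂ) * f.coeff n
  isPWO_support' := f.isPWO_support.mono fun n hn => by
    rw [Function.mem_support] at hn
    exact right_ne_zero_of_mul hn

lemma eulerSeries_coeff (f : LaurentSeries ℂ) (n : ℤ) :
    (eulerSeries f).coeff n = n * f.coeff n := rfl

lemma support_eulerSeries_subset (f : LaurentSeries ℂ) : (eulerSeries f).support ⊆ f.support :=
  fun n hn => by
    rw [HahnSeries.mem_support, eulerSeries_coeff] at hn
    exact right_ne_zero_of_mul hn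

lemma eulerSeries_mul (f g : LaurentSeries ℂ) :
    eulerSeries (f * g) = f * eulerSeries g + g * eulerSeries f := by
  ext n
  rw [mul_comm g, HahnSeries.coeff_add, eulerSeries_coeff,
    HahnSeries.coeff_mul_right' g.isPWO_support (support_eulerSeries_subset g),
    HahnSeries.coeff_mul_left' f.isPWO_support (support_eulerSeries_subset f),
    HahnSeries.coeff_mul, Finset.mul_sum, ← Finset.sum_add_distrib]
  refine Finset.sum_congr rfl fun ij hij => ?_
  have : n = ij.1 + ij.2 := (Finset.mem_antidiagonal.1 hij).2.2.symm
  simp only [this, eulerSeries_coeff]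
  push_cast
  ring

/-- The Euler derivation `T d/dT` on Laurent series. -/
def eulerDerivation : Derivation ℂ (LaurentSeries ℂ) (LaurentSeries ℂ) where
  toFun := eulerSeries
  map_add' f g := by
    ext n
    simp only [eulerSeries_coeff, HahnSeries.coeff_add, mul_add]
  map_smul' r f := by
    ext n
    exact mul_left_comm _ _ _
  map_one_eq_zero' := by
    ext n
    rcases eq_or_ne n 0 with rfl | hn
    · exact (eulerSeries_coeff _ _).trans (by simp)
    · exact (eulerSeries_coeff _ _).trans (by simp [HahnSeries.coeff_one, hn])
  leibniz' := eulerSeries_mul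

@[simp] lemma eulerDerivation_coeff (f : LaurentSeries ℂ) (n : ℤ) :
    (eulerDerivation f).coeff n = n * f.coeff n := rfl

/-- T d/dT kills the constant term. Since T d/dT stands for df/(dT/T), regularity of a differential
appears as strict positivity of the order. -/
lemma valuation_eulerDerivation_lt_one {f : LaurentSeries ℂ} (hf : Valued.v f ≤ (1 : WithZero (Multiplicative ℤ))) :
    Valued.v (eulerDerivation f) < (1 : WithZero (Multiplicative ℤ)) := by
  have h : Valued.v (eulerDerivation f) ≤ WithZero.exp (-1 : ℤ) := by
    rw [LaurentSeries.valuation_le_iff_coeff_lt_eq_zero]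
    intro n hn
    rw [← WithZero.exp_zero, ← neg_zero, LaurentSeries.valuation_le_iff_coeff_lt_eq_zero] at hf
    rcases eq_or_ne n 0 with rfl | h0
    · simp
    · rw [eulerDerivation_coeff, hf n (by omega), mul_zero]
  refine h.trans_lt ?_
  rw [← WithZero.exp_zero, WithZero.exp_lt_exp]
  norm_num

lemma eulerDerivation_single (n : ℤ) (a : ℂ) :
    eulerDerivation (HahnSeries.single n a) = HahnSeries.single n (n * a) := by
  ext m
  rcases eq_or_ne m n with rfl | h <;> simp [HahnSeries.coeff_single_of_ne, *]

/-- Scale the constant term to 1 and substitute F - 1 into the binomial series (1+X)^(1/2). -/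
lemma isSquare_powerSeries {F : PowerSeries ℂ} (hF : PowerSeries.constantCoeff F ≠ 0) :
    IsSquare F := by
  obtain ⟨b, hb⟩ := IsAlgClosed.exists_pow_nat_eq (PowerSeries.constantCoeff F) (n := 2) two_pos
  set G : PowerSeries ℂ := PowerSeries.C ((PowerSeries.constantCoeff F)⁻¹) * F - 1 with hG
  have hG0 : PowerSeries.constantCoeff G = 0 := by simp [hG, hF]
  have hs : PowerSeries.HasSubst G := PowerSeries.HasSubst.of_constantCoeff_zero' hG0
  have h1 : PowerSeries.binomialSeries ℂ (1 / 2 : ℚ) * PowerSeries.binomialSeries ℂ (1 / 2 : ℚ) =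
      1 + PowerSeries.X := by
    rw [← PowerSeries.binomialSeries_add, add_halves]
    simpa using PowerSeries.binomialSeries_nat (A := ℂ) (R := ℚ) 1
  have h2 := congrArg (PowerSeries.subst G) h1
  rw [PowerSeries.subst_mul hs, PowerSeries.subst_add hs, PowerSeries.subst_X hs,
    ← PowerSeries.coe_substAlgHom hs, map_one] at h2
  refine ⟨PowerSeries.C b * (PowerSeries.substAlgHom hs (PowerSeries.binomialSeries ℂ (1 / 2 : ℚ))), ?_⟩
  rw [mul_mul_mul_comm, h2, hG, ← map_mul, ← pow_two, hb, add_sub_cancel, ← mul_assoc, ← map_mul,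
    mul_inv_cancel₀ hF, map_one, one_mul]

lemma isSquare_algebraMap_laurent (a : ℂ) : IsSquare (algebraMap ℂ (LaurentSeries ℂ) a) := by
  obtain ⟨b, hb⟩ := IsAlgClosed.exists_pow_nat_eq a (n := 2) two_pos
  exact ⟨algebraMap _ _ b, by rw [← map_mul, ← pow_two, hb]⟩

lemma isSquare_add_single_two (a b : ℂ) :
    IsSquare (algebraMap ℂ (LaurentSeries ℂ) a + HahnSeries.single 2 b) := by
  rcases eq_or_ne a 0 with rfl | ha
  · obtain ⟨d, hd⟩ := IsAlgClosed.exists_pow_nat_eq b (n := 2) two_pos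
    refine ⟨HahnSeries.single 1 d, ?_⟩
    rw [map_zero, zero_add, HahnSeries.single_mul_single, ← pow_two, hd]
    norm_num
  · obtain ⟨G, hG⟩ := isSquare_powerSeries (F := PowerSeries.C a + PowerSeries.C b * PowerSeries.X ^ 2)
      (by simpa using ha)
    refine ⟨HahnSeries.ofPowerSeries ℤ ℂ G, ?_⟩
    rw [← map_mul, ← hG, map_add, map_mul, HahnSeries.ofPowerSeries_C, HahnSeries.ofPowerSeries_X_pow,
      HahnSeries.ofPowerSeries_C]
    simp [HahnSeries.C_apply, HahnSeries.single_mul_single, HahnSeries.algebraMap_apply]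

end Laurent

/-! ### Quadratic extensions -/

section Quadratic

lemma exists_sq_of_finrank_eq_two {F K : Type*} [Field F] [CharZero F] [Field K] [Algebra F K]
    (h : Module.finrank F K = 2) :
    ∃ (s : K) (p : F), s ^ 2 = algebraMap F K p ∧ (∀ b, b ^ 2 ≠ p) ∧
      ∀ f, ∃ α β : F, f = algebraMap F K α + algebraMap F K β * s := by
  have hfin : FiniteDimensional F K := Module.finite_of_finrank_pos (by omega)
  obtain ⟨s, hs⟩ : ∃ s : K, s ∉ (algebraMap F K).range := by
    by_contra! hall
    have hb : (⊥ : Subalgebra F K) = ⊤ := by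
      refine eq_top_iff.2 fun f _ => ?_
      exact Algebra.mem_bot.2 (hall f)
    have := Subalgebra.bot_eq_top_iff_finrank_eq_one.1 hb
    omega
  have hli : LinearIndependent F ![(1 : K), s] := by
    refine (LinearIndependent.pair_iff' one_ne_zero).2 fun a ha => hs ⟨a, ?_⟩
    rw [← ha, Algebra.smul_def, mul_one]
  have hspan : Submodule.span F (Set.range ![(1 : K), s]) = ⊤ :=
    hli.span_eq_top_of_card_eq_finrank' (by simp [h])
  have hrep : ∀ f, ∃ α β : F, f = algebraMap F K α + algebraMap F K β * s := fun f => by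
    have hf : f ∈ Submodule.span F (Set.range ![(1 : K), s]) := hspan ▸ Submodule.mem_top
    rw [Matrix.range_cons, Matrix.range_cons, Matrix.range_empty, Set.union_empty,
      Set.singleton_union, Submodule.mem_span_pair] at hf
    obtain ⟨a, b, hab⟩ := hf
    exact ⟨a, b, by rw [← hab, Algebra.smul_def, Algebra.smul_def, mul_one]⟩
  obtain ⟨a, b, hab⟩ := hrep (s ^ 2)
  have h2 : (algebraMap F K) 2 = 2 := map_ofNat _ 2
  have h20 : (2 : K) ≠ 0 := by rw [← h2]; simp
  -- Completing the square in s² = a + b s.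
  refine ⟨s - algebraMap F K (b / 2), a + (b / 2) ^ 2, ?_, fun c hc => hs ?_, fun f => ?_⟩
  · simp only [map_add, map_pow, map_div₀, h2]
    field_simp
    linear_combination 4 * hab
  · have h3 : (s - algebraMap F K (b / 2)) ^ 2 = (algebraMap F K c) ^ 2 := by
      rw [← map_pow, hc]
      simp only [map_add, map_pow, map_div₀, h2]
      field_simp
      linear_combination 4 * hab
    rcases sq_eq_sq_iff_eq_or_eq_neg.1 h3 with h4 | h4
    · exact ⟨c + b / 2, by rw [map_add, ← h4]; ring⟩
    · exact ⟨-c + b / 2, by rw [map_add, map_neg, ← h4]; ring⟩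
  · obtain ⟨α, β, hf⟩ := hrep f
    exact ⟨α + β * (b / 2), β, by rw [hf, map_add, map_mul]; ring⟩

lemma exists_algHom_of_sq {F K E : Type*} [Field F] [Field K] [Field E] [Algebra F K]
    [Algebra F E] {s : K} {p : F} (hs : s ^ 2 = algebraMap F K p) (hp : ∀ b, b ^ 2 ≠ p)
    (htop : F⟮s⟯ = ⊤) {S : E} (hS : S ^ 2 = algebraMap F E p) : ∃ φ : K →ₐ[F] E, φ s = S := by
  have hirr : Irreducible (X ^ 2 - C p) := X_pow_sub_C_irreducible_of_prime Nat.prime_two hp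
  have hmin : X ^ 2 - C p = minpoly F s :=
    minpoly.eq_of_irreducible_of_monic hirr (by simp [hs]) (monic_X_pow_sub_C _ two_ne_zero)
  have hint : IsIntegral F s := ⟨X ^ 2 - C p, monic_X_pow_sub_C _ two_ne_zero, by simp [hs]⟩
  have hroot : S ∈ (minpoly F s).aroots E := by
    rw [mem_aroots, ← hmin]
    exact ⟨hirr.ne_zero, by simp [hS]⟩
  let φ := (IntermediateField.algHomAdjoinIntegralEquiv F hint).symm ⟨S, hroot⟩
  let e : K ≃ₐ[F] F⟮s⟯ :=
    IntermediateField.topEquiv.symm.trans (IntermediateField.equivOfEq htop.symm)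
  refine ⟨φ.comp e.toAlgHom, ?_⟩
  have : e s = IntermediateField.AdjoinSimple.gen F s := rfl
  change φ (e s) = S
  rw [this]
  exact IntermediateField.algHomAdjoinIntegralEquiv_symm_apply_gen F hint ⟨S, hroot⟩

end Quadratic

/-! ### Laurent expansions of differentials -/

section Expansion

variable {K : Type} [Field K] [Algebra ℂ K]

/-- The derivation T d/dT ∘ φ factors through Ω by the universal property. The result is stated as
an additive map with its semilinearity so that the K-module structure on ℂ((T)) given by φ stays
local to the proof. -/
lemma exists_expansion_differential (φ : K →ₐ[ℂ] LaurentSeries ℂ) :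
    ∃ F : (Ω[K⁄ℂ]) →+ LaurentSeries ℂ, (∀ g ω, F (g • ω) = φ g * F ω) ∧
      ∀ f, F (KaehlerDifferential.D ℂ K f) = eulerDerivation (φ f) := by
  let _ := φ.toRingHom.toAlgebra
  have : IsScalarTower ℂ K (LaurentSeries ℂ) :=
    IsScalarTower.of_algebraMap_eq fun a => (φ.commutes a).symm
  let F := (eulerDerivation.compAlgebraMap K).liftKaehlerDifferential
  refine ⟨F.toAddMonoidHom, fun g ω => ?_, fun f => ?_⟩
  · exact (F.map_smul g ω).trans (Algebra.smul_def _ _)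
  · exact Derivation.liftKaehlerDifferential_comp_D _ f

/-- A regular differential has no pole along a Laurent expansion. -/
lemma valuation_expansion_lt_one {φ : K →ₐ[ℂ] LaurentSeries ℂ}
    (hφ : ∃ f, (1 : WithZero (Multiplicative ℤ)) < Valued.v (φ f)) {F : (Ω[K⁄ℂ]) →+ LaurentSeries ℂ}
    (hF : ∀ g ω, F (g • ω) = φ g * F ω)
    (hD : ∀ f, F (KaehlerDifferential.D ℂ K f) = eulerDerivation (φ f)) {ω : Ω[K⁄ℂ]}
    (hω : ω ∈ regularDifferentials K) :
    Valued.v (F ω) < (1 : WithZero (Multiplicative ℤ)) := by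
  -- The preimage of ℂ[[T]] is a closed point; the pole supplied by `hφ` makes it a proper subring.
  let P : ClosedPoint K :=
    { localRing := (Valued.v : Valuation (LaurentSeries ℂ) (WithZero (Multiplicative ℤ))).valuationSubring.comap
        φ.toRingHom
      algebraMap_mem := fun a => by
        have : (φ (algebraMap ℂ K a)) = HahnSeries.C a := φ.commutes a
        rw [ValuationSubring.mem_comap]
        change Valued.v (φ (algebraMap ℂ K a)) ≤ (1 : WithZero (Multiplicative ℤ))
        rw [this, LaurentSeries.val_le_one_iff_eq_coe]
        exact ⟨PowerSeries.C a, HahnSeries.ofPowerSeries_C a⟩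
      ne_top := fun htop => by
        obtain ⟨f, hf⟩ := hφ
        have : f ∈ (Valued.v : Valuation (LaurentSeries ℂ) (WithZero (Multiplicative ℤ))).valuationSubring.comap
            φ.toRingHom := htop ▸ ValuationSubring.mem_top f
        exact absurd hf (not_lt.2 this) }
  have h := hω P
  refine Submodule.span_induction (p := fun ω _ => Valued.v (F ω) < (1 : WithZero (Multiplicative ℤ)))
    ?_ ?_ ?_ ?_ h
  · rintro _ ⟨f, hf, rfl⟩
    rw [hD]
    exact valuation_eulerDerivation_lt_one hf
  · simp
  · intro a b _ _ ha hb
    rw [map_add]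
    exact Valuation.map_add_lt _ ha hb
  · intro r a _ ha
    have h1 : F (r • a) = φ r * F a := hF r a
    rw [h1, map_mul]
    exact (mul_le_of_le_one_left' r.2).trans_lt ha

/-- Over ℂ polynomials split into linear factors. This serves for nonvanishing, for being a square
and for lower bounds on valuations. -/
lemma aeval_mem_submonoid {E : Type*} [CommRing E] [Algebra ℂ E] {X₀ : E} (M : Submonoid E)
    (hM : ∀ a : ℂ, a ≠ 0 → algebraMap ℂ E a ∈ M) (h : ∀ a : ℂ, X₀ - algebraMap ℂ E a ∈ M)
    {A : ℂ[X]} (hA : A ≠ 0) : aeval X₀ A ∈ M := by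
  rw [(IsAlgClosed.splits A).eq_prod_roots, map_mul, aeval_C, map_multiset_prod]
  refine M.mul_mem (hM _ (leadingCoeff_ne_zero.2 hA)) (Submonoid.multiset_prod_mem _ _ ?_)
  intro e he
  obtain ⟨q, hq, rfl⟩ := Multiset.mem_map.1 he
  obtain ⟨a, -, rfl⟩ := Multiset.mem_map.1 hq
  simpa using h a

end Expansion

/-! ### Double covers of ℙ¹ and anti-invariance of their regular differentials -/

section DegreeTwo

variable {K : Type} [Field K] [Algebra ℂ K]

lemma valuation_algebraMap_laurent {a : ℂ} (ha : a ≠ 0) :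
    Valued.v (algebraMap ℂ (LaurentSeries ℂ) a) = (1 : WithZero (Multiplicative ℤ)) := by
  have h : ∀ b : ℂ, Valued.v (algebraMap ℂ (LaurentSeries ℂ) b) ≤ (1 : WithZero (Multiplicative ℤ)) :=
    fun b => (LaurentSeries.val_le_one_iff_eq_coe _ _).2 ⟨PowerSeries.C b, HahnSeries.ofPowerSeries_C b⟩
  refine le_antisymm (h a) ?_
  have h2 := h a⁻¹
  rw [map_inv₀, map_inv₀] at h2
  exact (inv_le_one₀ (zero_lt_iff.2 (by simpa using ha))).1 h2

lemma exists_aeval_div_aeval {x : K} (hx : Transcendental ℂ x) (l : ℂ⟮x⟯) :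
    ∃ A B : ℂ[X], IsCoprime A B ∧ B ≠ 0 ∧
      l = aeval (IntermediateField.AdjoinSimple.gen ℂ x) A /
        aeval (IntermediateField.AdjoinSimple.gen ℂ x) B := by
  let u := (RatFunc.algEquivOfTranscendental x hx).symm l
  refine ⟨u.num, u.denom, RatFunc.isCoprime_num_denom u, RatFunc.denom_ne_zero u, ?_⟩
  apply Subtype.ext
  have h := RatFunc.algEquivOfTranscendental_apply x hx u
  rw [AlgEquiv.apply_symm_apply] at h
  rw [h]
  change _ = (ℂ⟮x⟯).val (_ / _)
  rw [map_div₀, ← aeval_algHom_apply, ← aeval_algHom_apply]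
  rfl

lemma exists_algHom_laurent {x : K} (hx : Transcendental ℂ x) {X₀ : LaurentSeries ℂ}
    (hX₀ : Transcendental ℂ X₀) :
    ∃ ψ : ℂ⟮x⟯ →ₐ[ℂ] LaurentSeries ℂ, ψ (IntermediateField.AdjoinSimple.gen ℂ x) = X₀ := by
  refine ⟨(ℂ⟮X₀⟯).val.comp ((RatFunc.algEquivOfTranscendental X₀ hX₀).toAlgHom.comp
    (RatFunc.algEquivOfTranscendental x hx).symm.toAlgHom), ?_⟩
  change ((RatFunc.algEquivOfTranscendental X₀ hX₀ ((RatFunc.algEquivOfTranscendental x hx).symm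
    (IntermediateField.AdjoinSimple.gen ℂ x)) : ℂ⟮X₀⟯) : LaurentSeries ℂ) = X₀
  rw [RatFunc.algEquivOfTranscendental_symm_gen, RatFunc.algEquivOfTranscendental_X]

lemma transcendental_of_forall_ne {E : Type*} [Field E] [Algebra ℂ E] {X₀ : E}
    (h : ∀ a : ℂ, X₀ ≠ algebraMap ℂ E a) : Transcendental ℂ X₀ := by
  rw [transcendental_iff]
  intro A hA
  by_contra hA0
  refine nonZeroDivisors.ne_zero (aeval_mem_submonoid (nonZeroDivisors E) (fun a ha => ?_)
    (fun a => ?_) hA0) hA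
  · exact mem_nonZeroDivisors_of_ne_zero (by simpa using ha)
  · exact mem_nonZeroDivisors_of_ne_zero (sub_ne_zero.2 (h a))

/-- Expanding in the square root T of a local parameter of ℙ¹ makes every element of ℂ(x) a square,
so branched and unbranched points need no separate treatment. -/
lemma isSquare_map_of_forall_isSquare {x : K} (hx : Transcendental ℂ x)
    {ψ : ℂ⟮x⟯ →ₐ[ℂ] LaurentSeries ℂ} {X₀ : LaurentSeries ℂ}
    (hψ : ψ (IntermediateField.AdjoinSimple.gen ℂ x) = X₀)
    (hsq : ∀ a : ℂ, IsSquare (X₀ - algebraMap ℂ _ a)) (p : ℂ⟮x⟯) : IsSquare (ψ p) := by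
  obtain ⟨A, B, -, hB, hAB⟩ := exists_aeval_div_aeval hx p
  rcases eq_or_ne A 0 with rfl | hA
  · rw [hAB, map_zero, zero_div, map_zero]
    exact IsSquare.zero
  have hmem : ∀ {A : ℂ[X]}, A ≠ 0 → IsSquare (aeval X₀ A) := fun hA =>
    aeval_mem_submonoid (Submonoid.square (LaurentSeries ℂ))
      (fun a _ => isSquare_algebraMap_laurent a) hsq hA
  rw [hAB, map_div₀, ← aeval_algHom_apply, ← aeval_algHom_apply, hψ]
  exact (hmem hA).div (hmem hB)

lemma single_ne_algebraMap {n : ℤ} (b : ℂ) (hn : n ≠ 0) :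
    (HahnSeries.single n 1 : LaurentSeries ℂ) ≠ algebraMap ℂ (LaurentSeries ℂ) b := fun h => by
  have := congrArg (fun f : LaurentSeries ℂ => f.coeff n) h
  change (HahnSeries.single n (1 : ℂ)).coeff n = (HahnSeries.single 0 b).coeff n at this
  rw [HahnSeries.coeff_single_same, HahnSeries.coeff_single_of_ne hn] at this
  exact one_ne_zero this

lemma isSquare_single_neg_two_sub (a : ℂ) :
    IsSquare ((HahnSeries.single (-2) 1 : LaurentSeries ℂ) - algebraMap ℂ _ a) := by
  generalize hX₀ : (HahnSeries.single (-2) 1 : LaurentSeries ℂ) = X₀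
  have h : X₀ * HahnSeries.single 2 (-a) = algebraMap ℂ (LaurentSeries ℂ) (-a) := by
    rw [← hX₀, HahnSeries.single_mul_single, one_mul]
    rfl
  have e : X₀ - algebraMap ℂ _ a = X₀ * (algebraMap ℂ _ 1 + HahnSeries.single 2 (-a)) := by
    rw [mul_add, map_one, mul_one, h, map_neg, sub_eq_add_neg]
  rw [e]
  refine IsSquare.mul ⟨HahnSeries.single (-1) 1, ?_⟩ (isSquare_add_single_two _ _)
  rw [← hX₀, HahnSeries.single_mul_single]
  norm_num

/-- The field `K` is the quadratic extension of `ℂ(x)` generated by `s = √p`. -/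
structure IsDoubleCover (x s : K) (p : ℂ⟮x⟯) : Prop where
  transcendental : Transcendental ℂ x
  sq_eq : s ^ 2 = algebraMap ℂ⟮x⟯ K p
  sq_ne : ∀ b, b ^ 2 ≠ p
  exists_eq_add : ∀ f : K, ∃ α β : ℂ⟮x⟯, f = algebraMap ℂ⟮x⟯ K α + algebraMap ℂ⟮x⟯ K β * s

lemma IsDoubleCover.exists_extension {x s : K} {p : ℂ⟮x⟯} (h : IsDoubleCover x s p)
    (ψ : ℂ⟮x⟯ →ₐ[ℂ] LaurentSeries ℂ) {S : LaurentSeries ℂ} (hS : S ^ 2 = ψ p) :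
    ∃ φ : K →ₐ[ℂ] LaurentSeries ℂ, (∀ l : ℂ⟮x⟯, φ (algebraMap ℂ⟮x⟯ K l) = ψ l) ∧ φ s = S := by
  let _ := ψ.toRingHom.toAlgebra
  have : IsScalarTower ℂ ℂ⟮x⟯ (LaurentSeries ℂ) :=
    IsScalarTower.of_algebraMap_eq fun a => (ψ.commutes a).symm
  have htop : ℂ⟮x⟯⟮s⟯ = ⊤ := by
    refine eq_top_iff.2 fun f _ => ?_
    obtain ⟨α, β, rfl⟩ := h.exists_eq_add f
    exact add_mem (IntermediateField.algebraMap_mem _ _)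
      (mul_mem (IntermediateField.algebraMap_mem _ _)
        (IntermediateField.mem_adjoin_simple_self _ s))
  obtain ⟨φ, hφ⟩ := exists_algHom_of_sq h.sq_eq h.sq_ne htop (E := LaurentSeries ℂ) (S := S) hS
  exact ⟨φ.restrictScalars ℂ, fun l => φ.commutes l, hφ⟩

/-- The part of a regular differential that comes from `ℂ(x)` has no pole along an expansion of
`ℂ(x)` which extends in two ways to the quadratic extension `K`. -/
lemma IsDoubleCover.valuation_even_part_lt_one {x s : K} {p : ℂ⟮x⟯} (h : IsDoubleCover x s p)
    {ψ : ℂ⟮x⟯ →ₐ[ℂ] LaurentSeries ℂ} {X₀ : LaurentSeries ℂ}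
    (hψ : ψ (IntermediateField.AdjoinSimple.gen ℂ x) = X₀)
    (hsq : ∀ a : ℂ, IsSquare (X₀ - algebraMap ℂ _ a)) (hne : ∀ a : ℂ, X₀ ≠ algebraMap ℂ _ a)
    {a : ℂ} (ha : Valued.v (X₀ - algebraMap ℂ _ a) ≠ (1 : WithZero (Multiplicative ℤ)))
    {α β : ℂ⟮x⟯}
    (hω : (algebraMap ℂ⟮x⟯ K α + algebraMap ℂ⟮x⟯ K β * s) • KaehlerDifferential.D ℂ K x ∈
      regularDifferentials K) :
    Valued.v (ψ α * eulerDerivation X₀) < (1 : WithZero (Multiplicative ℤ)) := by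
  obtain ⟨S, hS⟩ := isSquare_map_of_forall_isSquare h.transcendental hψ hsq p
  have key : ∀ S' : LaurentSeries ℂ, S' ^ 2 = ψ p →
      Valued.v ((ψ α + ψ β * S') * eulerDerivation X₀) < (1 : WithZero (Multiplicative ℤ)) := by
    intro S' hS'
    obtain ⟨φ, hφψ, hφs⟩ := h.exists_extension ψ hS'
    have hφx : φ x = X₀ := by rw [← hψ, ← hφψ]; rfl
    obtain ⟨F, hF, hD⟩ := exists_expansion_differential φ
    have hpole : ∃ f, (1 : WithZero (Multiplicative ℤ)) < Valued.v (φ f) := by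
      have e : φ (x - algebraMap ℂ K a) = X₀ - algebraMap ℂ _ a := by
        rw [map_sub, hφx, AlgHom.commutes]
      rcases lt_or_gt_of_ne ha with h | h
      · refine ⟨(x - algebraMap ℂ K a)⁻¹, ?_⟩
        rw [map_inv₀, e, map_inv₀]
        exact (one_lt_inv₀ (zero_lt_iff.2 (by simpa using sub_ne_zero.2 (hne a)))).2 h
      · exact ⟨x - algebraMap ℂ K a, e ▸ h⟩
    have h := valuation_expansion_lt_one hpole hF hD hω
    rwa [hF, hD, map_add φ, map_mul φ, hφψ, hφψ, hφx, hφs] at h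
  have h1 := key S (by rw [hS, pow_two])
  have h2 := key (-S) (by rw [hS]; ring)
  -- The embeddings s ↦ S and s ↦ -S are both allowed; their sum removes β and leaves twice the even
  -- part.
  have h3 := Valuation.map_add_lt _ h1 h2
  have e : (ψ α + ψ β * S) * eulerDerivation X₀ + (ψ α + ψ β * -S) * eulerDerivation X₀ =
      algebraMap ℂ (LaurentSeries ℂ) 2 * (ψ α * eulerDerivation X₀) := by
    rw [map_ofNat]; ring
  rwa [e, map_mul, valuation_algebraMap_laurent two_ne_zero, one_mul] at h3

/-- A regular differential on a double cover of the projective line is anti-invariant. -/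
lemma IsDoubleCover.even_part_eq_zero {x s : K} {p : ℂ⟮x⟯} (hcov : IsDoubleCover x s p)
    {α β : ℂ⟮x⟯}
    (hω : (algebraMap ℂ⟮x⟯ K α + algebraMap ℂ⟮x⟯ K β * s) • KaehlerDifferential.D ℂ K x ∈
      regularDifferentials K) : α = 0 := by
  have hx := hcov.transcendental
  obtain ⟨A, B, hAB, hB0, hα⟩ := exists_aeval_div_aeval hx α
  have hconst : ∀ b : ℂ, Valued.v (algebraMap ℂ (LaurentSeries ℂ) b) ≤
      (1 : WithZero (Multiplicative ℤ)) := fun b => by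
    rcases eq_or_ne b 0 with rfl | hb
    · simp
    · exact (valuation_algebraMap_laurent hb).le
  have hvs : ∀ n : ℤ, Valued.v (HahnSeries.single n (1 : ℂ) : LaurentSeries ℂ) = WithZero.exp (-n) :=
    LaurentSeries.valuation_single_zpow ℂ
  have hsingle : ∀ (n : ℤ) (b : ℂ), HahnSeries.single n b =
      algebraMap ℂ (LaurentSeries ℂ) b * HahnSeries.single n 1 := fun n b => by
    change _ = HahnSeries.single 0 b * _
    rw [HahnSeries.single_mul_single, zero_add, mul_one]
  -- Expand at x = c + T². A pole of α at c has order at least 2 in T, while T d/dT of x is 2T², so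
  -- the product could not have positive order.
  have hB : ∀ c, ¬ B.IsRoot c := by
    intro c hc
    set T2 : LaurentSeries ℂ := HahnSeries.single 2 1 with hT2
    have hv : Valued.v T2 = WithZero.exp (-2 : ℤ) := hvs 2
    set X₀ : LaurentSeries ℂ := algebraMap ℂ _ c + T2 with hX₀
    have hX₀ne : ∀ a : ℂ, X₀ ≠ algebraMap ℂ _ a := fun a h => by
      refine single_ne_algebraMap (a - c) two_ne_zero ?_
      rw [map_sub, ← h, hX₀, add_sub_cancel_left]
    obtain ⟨ψ, hψ⟩ := exists_algHom_laurent hx (transcendental_of_forall_ne hX₀ne)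
    have h := hcov.valuation_even_part_lt_one (a := c) hψ (fun a => by
        have : X₀ - algebraMap ℂ _ a = algebraMap ℂ _ (c - a) + T2 := by
          rw [hX₀, map_sub]; ring
        rw [this]
        exact isSquare_add_single_two _ _) hX₀ne (by
        rw [hX₀, add_sub_cancel_left, hv, ← WithZero.exp_zero, Ne, WithZero.exp_inj]
        norm_num) hω
    have hθ : Valued.v (eulerDerivation X₀) = WithZero.exp (-2 : ℤ) := by
      rw [hX₀, map_add, Derivation.map_algebraMap, zero_add, hT2, eulerDerivation_single, hsingle,
        map_mul, valuation_algebraMap_laurent (by simp), one_mul, hvs]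
    rw [map_mul, hθ, hα, map_div₀, ← aeval_algHom_apply, ← aeval_algHom_apply, hψ] at h
    have hX₀le : Valued.v X₀ ≤ (1 : WithZero (Multiplicative ℤ)) := by
      refine Valuation.map_add_le _ (hconst c) ?_
      rw [hv, ← WithZero.exp_zero, WithZero.exp_le_exp]
      norm_num
    have hint : ∀ Q : ℂ[X], Valued.v (aeval X₀ Q) ≤ (1 : WithZero (Multiplicative ℤ)) := by
      intro Q
      induction Q using Polynomial.induction_on' with
      | add Q R hQ hR => rw [map_add]; exact Valuation.map_add_le _ hQ hR
      | monomial n b =>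
        rw [aeval_monomial, map_mul, map_pow]
        exact mul_le_one' (hconst b) (pow_le_one₀ zero_le hX₀le)
    obtain ⟨B₁, rfl⟩ := dvd_iff_isRoot.2 hc
    -- The Bézout relation UA + VB = 1 bounds the order of A/B at c from above, with no need to
    -- compute the order of A.
    obtain ⟨U, V, hUV⟩ := hAB
    have hvB : Valued.v (aeval X₀ ((X - C c) * B₁)) ≤ WithZero.exp (-2 : ℤ) := by
      have e : aeval X₀ (X - C c) = T2 := by simp [hX₀]
      rw [map_mul, map_mul, e, hv]
      exact mul_le_of_le_one_right' (hint B₁)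
    set vα := Valued.v (aeval X₀ A / aeval X₀ ((X - C c) * B₁)) with hvα
    have hlt : Valued.v (aeval X₀ U * (aeval X₀ A / aeval X₀ ((X - C c) * B₁)) + aeval X₀ V) <
        WithZero.exp (2 : ℤ) := by
      have h2 : vα < WithZero.exp (2 : ℤ) := by
        rwa [WithZero.exp_neg, ← div_eq_mul_inv, div_lt_one₀ (by simp)] at h
      refine Valuation.map_add_lt _ ?_ ((hint V).trans_lt ?_)
      · rw [map_mul]
        exact (mul_le_of_le_one_left' (hint U)).trans_lt h2
      · rw [← WithZero.exp_zero, WithZero.exp_lt_exp]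
        norm_num
    have hB0' : aeval X₀ ((X - C c) * B₁) ≠ 0 := fun h0 =>
      hB0 ((transcendental_iff.1 (transcendental_of_forall_ne hX₀ne)) _ h0)
    have e1 : (aeval X₀ U * (aeval X₀ A / aeval X₀ ((X - C c) * B₁)) + aeval X₀ V) *
        aeval X₀ ((X - C c) * B₁) = 1 := by
      have : aeval X₀ (U * A + V * ((X - C c) * B₁)) = aeval X₀ (1 : ℂ[X]) := by rw [hUV]
      rw [map_add, map_mul, map_mul _ V, map_one] at this
      rw [add_mul, mul_assoc, div_mul_cancel₀ _ hB0', this]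
    have e2 := congrArg Valued.v e1
    rw [map_mul, map_one] at e2
    have h3 : Valued.v (aeval X₀ U * (aeval X₀ A / aeval X₀ ((X - C c) * B₁)) + aeval X₀ V) *
        WithZero.exp (-2 : ℤ) < 1 := by
      rwa [WithZero.exp_neg, ← div_eq_mul_inv, div_lt_one₀ (by simp)]
    exact absurd e2 (((mul_le_mul_right hvB _).trans_lt h3).ne)
  have hBdeg : B.degree = 0 := by
    by_contra hdeg
    obtain ⟨c, hc⟩ := IsAlgClosed.exists_root B hdeg
    exact hB c hc
  obtain ⟨b, rfl⟩ : ∃ b, B = C b := ⟨_, eq_C_of_degree_eq_zero hBdeg⟩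
  have hb : b ≠ 0 := by simpa using hB0
  by_contra hα0
  have hA : A ≠ 0 := by
    rintro rfl
    rw [map_zero, zero_div] at hα
    exact hα0 hα
  -- Now α is a polynomial, and the point at infinity x = T⁻² remains: there dx contributes a pole
  -- that a nonzero polynomial cannot cancel.
  set X₀ : LaurentSeries ℂ := HahnSeries.single (-2) 1 with hX₀
  have hv : Valued.v X₀ = WithZero.exp (2 : ℤ) := by rw [hX₀, hvs, neg_neg]
  have hv1 : (1 : WithZero (Multiplicative ℤ)) < Valued.v X₀ := by
    rw [hv, ← WithZero.exp_zero, WithZero.exp_lt_exp]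
    norm_num
  have hX₀ne : ∀ a : ℂ, X₀ ≠ algebraMap ℂ _ a := fun a => single_ne_algebraMap a (by norm_num)
  obtain ⟨ψ, hψ⟩ := exists_algHom_laurent hx (transcendental_of_forall_ne hX₀ne)
  have hX₀sq : ∀ a : ℂ, IsSquare (X₀ - algebraMap ℂ (LaurentSeries ℂ) a) := isSquare_single_neg_two_sub
  have hvsub : ∀ a : ℂ, Valued.v (X₀ - algebraMap ℂ (LaurentSeries ℂ) a) = WithZero.exp (2 : ℤ) := fun a => by
    rw [Valuation.map_sub_eq_of_lt_left _ ((hconst a).trans_lt hv1), hv]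
  have h := hcov.valuation_even_part_lt_one (a := 0) hψ hX₀sq hX₀ne
    (by rw [map_zero, sub_zero]; exact hv1.ne') hω
  have hθ : Valued.v (eulerDerivation X₀) = WithZero.exp (2 : ℤ) := by
    rw [hX₀, eulerDerivation_single, hsingle, map_mul, valuation_algebraMap_laurent (by simp),
      one_mul, hvs, neg_neg]
  rw [map_mul, hθ, hα, map_div₀, ← aeval_algHom_apply, ← aeval_algHom_apply, hψ, aeval_C, map_div₀,
    valuation_algebraMap_laurent hb, div_one] at h
  have hvA : (1 : WithZero (Multiplicative ℤ)) ≤ Valued.v (aeval X₀ A) :=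
    aeval_mem_submonoid ((Submonoid.oneLE (WithZero (Multiplicative ℤ))).comap
      (Valued.v : Valuation (LaurentSeries ℂ) (WithZero (Multiplicative ℤ))))
      (fun a ha => (valuation_algebraMap_laurent ha).ge)
      (fun a => by
        change (1 : WithZero (Multiplicative ℤ)) ≤ Valued.v (X₀ - algebraMap ℂ _ a)
        rw [hvsub a, ← hv]; exact hv1.le) hA
  exact absurd h (not_lt.2 (one_le_mul hvA (hv ▸ hv1.le)))

end DegreeTwo

/-! ### Quotients of regular differentials -/

section AntiInvariance

variable {K : Type} [Field K] [Algebra ℂ K]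

/-- The field operations preserve the property on ℂ(x), and 2s ds = dp extends it to s. -/
lemma IsDoubleCover.exists_D_eq_smul {x s : K} {p : ℂ⟮x⟯} (h : IsDoubleCover x s p) (f : K) :
    ∃ γ : K, KaehlerDifferential.D ℂ K f = γ • KaehlerDifferential.D ℂ K x := by
  have hmem : ∀ f ∈ ℂ⟮x⟯, ∃ γ : K, KaehlerDifferential.D ℂ K f =
      γ • KaehlerDifferential.D ℂ K x := fun f hf => by
    induction hf using IntermediateField.adjoin_induction with
    | mem y hy => exact ⟨1, by rw [Set.mem_singleton_iff.1 hy, one_smul]⟩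
    | algebraMap a => exact ⟨0, by rw [Derivation.map_algebraMap, zero_smul]⟩
    | add a b _ _ ha hb =>
      obtain ⟨α, ha⟩ := ha
      obtain ⟨β, hb⟩ := hb
      exact ⟨α + β, by rw [map_add, ha, hb, add_smul]⟩
    | inv a _ ha =>
      obtain ⟨α, ha⟩ := ha
      exact ⟨-a⁻¹ ^ 2 * α, by rw [Derivation.leibniz_inv, ha, smul_smul]⟩
    | mul a b _ _ ha hb =>
      obtain ⟨α, ha⟩ := ha
      obtain ⟨β, hb⟩ := hb
      exact ⟨a * β + b * α, by rw [Derivation.leibniz, ha, hb, smul_smul, smul_smul, add_smul]⟩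
  have hs0 : s ≠ 0 := by
    rintro rfl
    refine h.sq_ne 0 ((algebraMap ℂ⟮x⟯ K).injective ?_)
    rw [← h.sq_eq, map_pow, map_zero]
  have h2 : (2 : K) ≠ 0 := by
    rw [← map_ofNat (algebraMap ℂ K) 2]
    simp
  obtain ⟨σ, hσ⟩ := hmem _ p.2
  have hs : KaehlerDifferential.D ℂ K s = ((2 * s)⁻¹ * σ) • KaehlerDifferential.D ℂ K x := by
    have e : s ^ 2 = (p : K) := h.sq_eq
    rw [← e, pow_two, Derivation.leibniz, ← add_smul, ← two_mul] at hσ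
    rw [mul_smul, ← hσ, smul_smul, inv_mul_cancel₀ (mul_ne_zero h2 hs0), one_smul]
  obtain ⟨α, β, rfl⟩ := h.exists_eq_add f
  obtain ⟨a, ha⟩ := hmem _ α.2
  obtain ⟨b, hb⟩ := hmem _ β.2
  refine ⟨a + β * ((2 * s)⁻¹ * σ) + s * b, ?_⟩
  have ha' : KaehlerDifferential.D ℂ K (algebraMap ℂ⟮x⟯ K α) = _ := ha
  have hb' : KaehlerDifferential.D ℂ K (algebraMap ℂ⟮x⟯ K β) = _ := hb
  rw [map_add, Derivation.leibniz, ha', hb', hs, smul_smul, smul_smul, add_smul, add_smul, add_assoc]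
  rfl

/-- Any expansion of K in ℂ((T)) works: T d/dT kills only constants, so dz = 0 would force z to be
constant. -/
lemma IsDoubleCover.D_ne_zero {x s : K} {p : ℂ⟮x⟯} (h : IsDoubleCover x s p) {z : K}
    (hz : Transcendental ℂ z) : KaehlerDifferential.D ℂ K z ≠ 0 := by
  intro h0
  obtain ⟨ψ, hψ⟩ := exists_algHom_laurent h.transcendental
    (transcendental_of_forall_ne (X₀ := HahnSeries.single (-2) 1)
      fun a => single_ne_algebraMap a (by norm_num))
  obtain ⟨S, hS⟩ := isSquare_map_of_forall_isSquare h.transcendental hψ isSquare_single_neg_two_sub p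
  obtain ⟨φ, -, -⟩ := h.exists_extension ψ (S := S) (by rw [hS, pow_two])
  obtain ⟨F, -, hD⟩ := exists_expansion_differential φ
  have h1 : eulerDerivation (φ z) = 0 := by rw [← hD, h0, map_zero]
  refine hz.ne_algebraMap ((φ z).coeff 0) (φ.toRingHom.injective ?_)
  change φ z = φ (algebraMap ℂ K _)
  rw [AlgHom.commutes]
  ext n
  change _ = (HahnSeries.single 0 ((φ z).coeff 0)).coeff n
  rcases eq_or_ne n 0 with rfl | hn
  · rw [HahnSeries.coeff_single_same]
  · rw [HahnSeries.coeff_single_of_ne hn]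
    have h2 := congrArg (fun f : LaurentSeries ℂ => f.coeff n) h1
    simp only [eulerDerivation_coeff, HahnSeries.coeff_zero, mul_eq_zero, Int.cast_eq_zero] at h2
    exact h2.resolve_left hn

lemma HasDegreeTwoMapToP1.exists_isDoubleCover (h : HasDegreeTwoMapToP1 K) :
    ∃ (x s : K) (p : ℂ⟮x⟯), IsDoubleCover x s p := by
  obtain ⟨x, hx, h2⟩ := h
  obtain ⟨s, p, hs, hp, hrep⟩ := exists_sq_of_finrank_eq_two h2
  exact ⟨x, s, p, hx, hs, hp, hrep⟩

/-- On a curve with a degree two map to the projective line, the quotients of the regular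
differentials lie in a proper subfield. -/
theorem IsDoubleCover.div_mem_adjoin {x s : K} {p : ℂ⟮x⟯} (h : IsDoubleCover x s p) {z : K}
    (hz : Transcendental ℂ z) {f g : K}
    (hf : f • KaehlerDifferential.D ℂ K z ∈ regularDifferentials K)
    (hg : g • KaehlerDifferential.D ℂ K z ∈ regularDifferentials K) : f / g ∈ ℂ⟮x⟯ := by
  obtain ⟨γ, hγ⟩ := h.exists_D_eq_smul z
  have hγ0 : γ ≠ 0 := by
    rintro rfl
    exact h.D_ne_zero hz (by rw [hγ, zero_smul])
  have hs0 : s ≠ 0 := by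
    rintro rfl
    refine h.sq_ne 0 ((algebraMap ℂ⟮x⟯ K).injective ?_)
    rw [← h.sq_eq, map_pow, map_zero]
  -- With dz = γ dx, anti-invariance says fγ ∈ ℂ(x)·s, so the factor s/γ cancels in a quotient.
  have key : ∀ f : K, f • KaehlerDifferential.D ℂ K z ∈ regularDifferentials K →
      ∃ β : ℂ⟮x⟯, f = β * s / γ := fun f hf => by
    obtain ⟨α, β, hαβ⟩ := h.exists_eq_add (f * γ)
    rw [hγ, smul_smul, hαβ] at hf
    rw [h.even_part_eq_zero hf, map_zero, zero_add] at hαβ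
    exact ⟨β, by rw [eq_div_iff hγ0, hαβ]; rfl⟩
  obtain ⟨α, rfl⟩ := key f hf
  obtain ⟨β, rfl⟩ := key g hg
  rw [div_div_div_cancel_right₀ hγ0, mul_div_mul_right _ _ hs0]
  exact div_mem α.2 β.2

lemma IsDoubleCover.adjoin_ne_top {x s : K} {p : ℂ⟮x⟯} (h : IsDoubleCover x s p) : ℂ⟮x⟯ ≠ ⊤ := by
  intro htop
  have hs : s ∈ ℂ⟮x⟯ := htop ▸ IntermediateField.mem_top
  refine h.sq_ne ⟨s, hs⟩ (Subtype.ext h.sq_eq)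

end AntiInvariance

/-! ### Constructing degree two maps -/

section Converse

lemma finrank_eq_two_or_mem_range {F K : Type*} [Field F] [Field K] [Algebra F K] {w : K}
    (htop : F⟮w⟯ = ⊤) {b c : F} (hw : w ^ 2 = algebraMap F K b * w + algebraMap F K c) :
    Module.finrank F K = 2 ∨ w ∈ (algebraMap F K).range := by
  let q : F[X] := X ^ 2 - (C b * X + C c)
  have hdeg : (C b * X + C c).degree < ((2 : ℕ) : WithBot ℕ) :=
    degree_linear_le.trans_lt (by norm_num)
  have hmonic : q.Monic := monic_X_pow_sub hdeg
  have hq : aeval w q = 0 := by simp [q, hw]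
  have hint : IsIntegral F w := ⟨q, hmonic, hq⟩
  have hqdeg : q.natDegree ≤ 2 := by
    refine natDegree_le_of_degree_le ((degree_sub_le _ _).trans (max_le ?_ hdeg.le))
    exact degree_X_pow_le 2
  have hle : (minpoly F w).natDegree ≤ 2 :=
    (natDegree_le_of_dvd (minpoly.dvd F w hq) hmonic.ne_zero).trans hqdeg
  have hfin : Module.finrank F K = (minpoly F w).natDegree := by
    rw [← IntermediateField.adjoin.finrank hint, htop, IntermediateField.finrank_top']
  have hpos := minpoly.natDegree_pos hint
  rcases (show (minpoly F w).natDegree = 1 ∨ (minpoly F w).natDegree = 2 by omega) with h | h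
  · exact Or.inr (minpoly.natDegree_eq_one_iff.1 h)
  · exact Or.inl (hfin.trans h)

variable {K : Type} [Field K] [Algebra ℂ K]

/-- Otherwise X·B(X²) = A(X²), an odd degree equal to an even one. -/
lemma notMem_adjoin_sq {t : K} (ht : Transcendental ℂ t) : t ∉ ℂ⟮t ^ 2⟯ := by
  intro hmem
  obtain ⟨A, B, hAB⟩ := (IntermediateField.mem_adjoin_simple_iff ℂ t).1 hmem
  have ht0 : t ≠ 0 := by simpa using ht.ne_algebraMap 0
  have hB : aeval (t ^ 2) B ≠ 0 := fun h => ht0 (by rw [hAB, h, div_zero])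
  rw [eq_div_iff hB] at hAB
  have h := (transcendental_iff.1 ht) (X * expand ℂ 2 B - expand ℂ 2 A)
    (by simp [expand_aeval, hAB])
  rw [sub_eq_zero] at h
  have hB0 : B ≠ 0 := by rintro rfl; simp at hB
  have hd := congrArg natDegree h
  rw [natDegree_X_mul (by rwa [Ne, expand_eq_zero two_pos]), natDegree_expand, natDegree_expand] at hd
  omega

lemma adjoin_adjoin_simple_eq_top {t w : K} (h : IntermediateField.adjoin ℂ {t, w} = ⊤) :
    ℂ⟮t⟯⟮w⟯ = ⊤ := by
  have h1 := IntermediateField.adjoin_adjoin_left ℂ {t} {w}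
  rw [Set.singleton_union, h] at h1
  rw [← IntermediateField.restrictScalars_eq_top_iff (K := ℂ)]
  exact h1

/-- A field that is at most quadratic over `ℂ(t)` is quadratic over some `ℂ(x)`. -/
lemma hasDegreeTwoMapToP1_of_sq_eq {t w : K} (ht : Transcendental ℂ t)
    (htop : IntermediateField.adjoin ℂ {t, w} = ⊤) {b c : K} (hb : b ∈ ℂ⟮t⟯) (hc : c ∈ ℂ⟮t⟯)
    (hw : w ^ 2 = b * w + c) : HasDegreeTwoMapToP1 K := by
  rcases finrank_eq_two_or_mem_range (b := ⟨b, hb⟩) (c := ⟨c, hc⟩)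
    (adjoin_adjoin_simple_eq_top htop) hw with h | ⟨w', hw'⟩
  · exact ⟨t, ht, h⟩
  · have hwt : w ∈ ℂ⟮t⟯ := by
      rw [← hw']
      exact w'.2
    -- In the degenerate case K = ℂ(t), and t² has degree two.
    have htop' : IntermediateField.adjoin ℂ {t ^ 2, t} = ⊤ := by
      rw [eq_top_iff, ← htop, IntermediateField.adjoin_le_iff]
      have hle : ℂ⟮t⟯ ≤ IntermediateField.adjoin ℂ {t ^ 2, t} :=
        IntermediateField.adjoin_simple_le_iff.2 (IntermediateField.subset_adjoin _ _ (by simp))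
      rintro x (rfl | rfl)
      · exact hle (IntermediateField.mem_adjoin_simple_self ℂ _)
      · exact hle hwt
    have hsq := IntermediateField.mem_adjoin_simple_self ℂ (t ^ 2)
    rcases finrank_eq_two_or_mem_range (b := (0 : ℂ⟮t ^ 2⟯)) (c := ⟨t ^ 2, hsq⟩)
      (adjoin_adjoin_simple_eq_top htop') (by rw [map_zero, zero_mul, zero_add]; rfl) with
      h | ⟨t', ht'⟩
    · exact ⟨t ^ 2, ht.pow two_pos, h⟩
    · have h : (t' : K) = t := ht'
      have hmem := t'.2
      rw [h] at hmem
      exact absurd hmem (notMem_adjoin_sq ht)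

end Converse

/-! ### The criterion and the genus bound for the normal form -/

namespace IsCyclicCover

variable {K : Type} [Field K] [Algebra ℂ K] {N c : ℕ} {μ : ℂ} {z y : K}

/-- The forms with (j,k) = (1,0), (2,0) and (m+1,1), where m = ⌊N/c⌋, have quotients y and y^m
(1-z)/(1-μz). Both lie in ℂ(x), hence so do y and, inverting a Möbius map, z. -/
lemma not_hasDegreeTwoMapToP1 (h : IsCyclicCover N c μ z y) (hc : 2 ≤ c) (hcN : 2 * c < N) :
    ¬ HasDegreeTwoMapToP1 K := by
  intro hdeg
  obtain ⟨x, s, p, hcov⟩ := hdeg.exists_isDoubleCover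
  have hz0 := h.z_ne_zero
  have hy0 := h.y_ne_zero
  have hp0 := h.transcendental.one_sub_mul_ne_zero μ
  have h1 := h.eigenDifferential_mem (j := 1) (k := 0) (by omega) (by omega) (by omega) (by omega)
  have h2 := h.eigenDifferential_mem (j := 2) (k := 0) (by omega) (by omega) (by omega) (by omega)
  -- m + 1 is the least j with jc > N, as k = 1 requires; c ≥ 2 keeps it below N.
  have hj : N < (N / c + 1) * c := by
    rw [add_mul, one_mul]
    exact Nat.lt_div_mul_add (by omega)
  have hj' : (N / c + 1) * c < 2 * N := by
    rw [add_mul, one_mul]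
    have := Nat.div_mul_le_self N c
    omega
  have hj'' : N / c ≤ N / 2 := Nat.div_le_div_left hc two_pos
  generalize N / c = m at hj hj' hj''
  have h3 := h.eigenDifferential_mem (j := m + 1) (k := 1) (by omega) (by omega) (by omega)
    (by omega)
  have hyL : y ∈ ℂ⟮x⟯ := by
    convert hcov.div_mem_adjoin h.transcendental h2 h1 using 1
    field_simp
  have hrL : (1 - z) / (1 - algebraMap ℂ K μ * z) ∈ ℂ⟮x⟯ := by
    have e := div_mem (hcov.div_mem_adjoin h.transcendental h3 h1) (pow_mem hyL m)
    convert e using 1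
    simp only [zero_add, one_add_one_eq_two, pow_zero, pow_one, pow_succ y m]
    field_simp
  set r := (1 - z) / (1 - algebraMap ℂ K μ * z) with hr
  rw [eq_div_iff hp0] at hr
  clear_value r
  have hzL : z ∈ ℂ⟮x⟯ := by
    have hμr : 1 - algebraMap ℂ K μ * r ≠ 0 := by
      intro h0
      have h4 : (1 : K) - algebraMap ℂ K μ = 0 := by
        linear_combination (1 - algebraMap ℂ K μ * z) * h0 + algebraMap ℂ K μ * hr
      rw [sub_eq_zero, eq_comm, ← map_one (algebraMap ℂ K)] at h4
      exact h.ne_one ((algebraMap ℂ K).injective h4)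
    have e : z = (1 - r) / (1 - algebraMap ℂ K μ * r) := by
      rw [eq_div_iff hμr]
      linear_combination hr
    rw [e]
    exact div_mem (sub_mem (one_mem _) hrL)
      (sub_mem (one_mem _) (mul_mem (IntermediateField.algebraMap_mem _ _) hrL))
  refine hcov.adjoin_ne_top (eq_top_iff.2 ?_)
  rw [← h.adjoin_eq_top, IntermediateField.adjoin_le_iff]
  rintro f (rfl | rfl)
  · exact hzL
  · exact hyL

/-- The relation is μz² - (1 + y^N)z + y^N = 0. Were y constant, this would make z algebraic. -/
lemma hasDegreeTwoMapToP1_of_eq_one (h : IsCyclicCover N 1 μ z y) : HasDegreeTwoMapToP1 K := by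
  have hrel := h.pow_mul_eq
  rw [pow_one, pow_one] at hrel
  have hμ : algebraMap ℂ K μ ≠ 0 := by simpa using h.ne_zero
  have hy : Transcendental ℂ y := transcendental_of_forall_ne fun a ha => by
    have h0 := (transcendental_iff.1 h.transcendental)
      (C μ * X ^ 2 - C (1 + a ^ N) * X + C (a ^ N)) (by
        rw [ha, ← map_pow] at hrel
        simp only [map_add, map_sub, map_mul, aeval_C, aeval_X, map_pow, map_one] at hrel ⊢
        linear_combination hrel)
    have h1 := congrArg (fun Q : ℂ[X] => Q.coeff 2) h0
    simp only [coeff_add, coeff_sub, coeff_C_mul, coeff_X_pow, coeff_X, coeff_C] at h1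
    exact h.ne_zero (by simpa using h1)
  have hyL := IntermediateField.mem_adjoin_simple_self ℂ y
  have hμL := IntermediateField.algebraMap_mem ℂ⟮y⟯ μ
  refine hasDegreeTwoMapToP1_of_sq_eq (w := z) hy (by rw [Set.pair_comm]; exact h.adjoin_eq_top)
    (b := (1 + y ^ N) / algebraMap ℂ K μ) (c := -y ^ N / algebraMap ℂ K μ)
    (div_mem (add_mem (one_mem _) (pow_mem hyL N)) hμL)
    (div_mem (neg_mem (pow_mem hyL N)) hμL) ?_
  field_simp
  linear_combination hrel

lemma hasDegreeTwoMapToP1_of_two_mul_eq (h : IsCyclicCover (2 * c) c μ z y) :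
    HasDegreeTwoMapToP1 K := by
  have hq0 := h.transcendental.one_sub_ne_zero
  have hp0 := h.transcendental.one_sub_mul_ne_zero μ
  have hy0 := h.y_ne_zero
  set t := y ^ 2 * (1 - z) / (1 - algebraMap ℂ K μ * z) with ht
  have htz : t ^ c = z := by
    rw [ht, div_pow, mul_pow, ← pow_mul, div_eq_iff (pow_ne_zero _ hp0), h.pow_mul_eq]
  have htr : Transcendental ℂ t := fun halg => h.transcendental (htz ▸ halg.pow c)
  have htL := IntermediateField.mem_adjoin_simple_self ℂ t
  have hzL : z ∈ ℂ⟮t⟯ := by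
    have := pow_mem htL c
    rwa [htz] at this
  refine hasDegreeTwoMapToP1_of_sq_eq (w := y) htr ?_ (b := 0)
    (c := t * (1 - algebraMap ℂ K μ * z) / (1 - z)) (zero_mem _)
    (div_mem (mul_mem htL (sub_mem (one_mem _) (mul_mem (IntermediateField.algebraMap_mem _ _) hzL)))
      (sub_mem (one_mem _) hzL)) ?_
  · rw [eq_top_iff, ← h.adjoin_eq_top, IntermediateField.adjoin_le_iff]
    rintro f (rfl | rfl)
    · have hle : ℂ⟮t⟯ ≤ IntermediateField.adjoin ℂ {t, y} :=
        IntermediateField.adjoin_simple_le_iff.2 (IntermediateField.subset_adjoin _ _ (by simp))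
      exact hle hzL
    · exact IntermediateField.subset_adjoin _ _ (by simp)
  · rw [zero_mul, zero_add, eq_div_iff hq0, ht, div_mul_cancel₀ _ hp0]

theorem hasDegreeTwoMapToP1_iff (h : IsCyclicCover N c μ z y) (hc : 2 * c ≤ N) :
    HasDegreeTwoMapToP1 K ↔ c = 1 ∨ 2 * c = N := by
  constructor
  · intro hdeg
    by_contra! hne
    have := h.pos
    exact h.not_hasDegreeTwoMapToP1 (by omega) (by omega) hdeg
  · rintro (rfl | rfl)
    · exact h.hasDegreeTwoMapToP1_of_eq_one
    · exact h.hasDegreeTwoMapToP1_of_two_mul_eq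

/-- The eigendifferentials (1,0) and (N-1,c-1) are regular and independent. The degree two map is
needed only for dz ≠ 0. -/
theorem two_le_genus (h : IsCyclicCover N c μ z y) (hN : 3 ≤ N) (hdeg : HasDegreeTwoMapToP1 K) :
    2 ≤ genus K := by
  obtain ⟨x, s, p, hcov⟩ := hdeg.exists_isDoubleCover
  have hD := hcov.D_ne_zero h.transcendental
  have hz0 := h.z_ne_zero
  have hy0 := h.y_ne_zero
  have hp0 := h.transcendental.one_sub_mul_ne_zero μ
  have hq0 := h.transcendental.one_sub_ne_zero
  have hc := h.pos
  have hcN := h.lt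
  obtain ⟨n, rfl⟩ : ∃ n, N = n + 3 := ⟨N - 3, by omega⟩
  obtain ⟨d, rfl⟩ : ∃ d, c = d + 1 := ⟨c - 1, by omega⟩
  have h1 := h.eigenDifferential_mem (j := 1) (k := 0) (by omega) (by omega) (by omega) (by omega)
  have h2 := h.eigenDifferential_mem (j := n + 2) (k := d) (by omega) (by omega) (by nlinarith)
    (by nlinarith)
  have hli : LinearIndependent ℂ ![(⟨_, h1⟩ : regularDifferentials K), ⟨_, h2⟩] := by
    refine (LinearIndependent.pair_iff' ?_).2 fun a ha => ?_
    · intro h0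
      have h0' := congrArg Subtype.val h0
      refine (smul_ne_zero ?_ hD) h0'
      simp [hy0, hp0, hz0]
    · have ha' := congrArg Subtype.val ha
      change a • eigenDifferential μ z y 1 0 = eigenDifferential μ z y (n + 2) d at ha'
      rw [eigenDifferential, eigenDifferential, ← algebraMap_smul K a, smul_smul] at ha'
      have e := smul_left_injective K hD ha'
      have e1 : algebraMap ℂ K a * (1 - algebraMap ℂ K μ * z) ^ d = y ^ (n + 1) * (1 - z) ^ d := by
        field_simp at e
        rw [zero_add, pow_one, pow_succ _ d] at e
        refine mul_right_cancel₀ (mul_ne_zero hy0 hp0) ?_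
        linear_combination e
      -- The N-th power of a proportionality eliminates y; the resulting polynomial identity in z,
      -- evaluated at 0, forces a = 0.
      have e2 : algebraMap ℂ K a ^ (n + 3) * (1 - algebraMap ℂ K μ * z) ^ (d * (n + 3)) *
          (1 - z) ^ ((d + 1) * (n + 1)) = z ^ (n + 1) *
          (1 - algebraMap ℂ K μ * z) ^ ((d + 1) * (n + 1)) * (1 - z) ^ (d * (n + 3)) := by
        have e3 := congrArg (· ^ (n + 3)) e1
        have e4 := congrArg (· ^ (n + 1)) h.pow_mul_eq
        simp only [mul_pow, ← pow_mul] at e3 e4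
        rw [e3, ← e4, mul_comm (n + 1) (n + 3)]
        ring
      have h0 := (transcendental_iff.1 h.transcendental)
        (C (a ^ (n + 3)) * (1 - C μ * X) ^ (d * (n + 3)) * (1 - X) ^ ((d + 1) * (n + 1)) -
          X ^ (n + 1) * (1 - C μ * X) ^ ((d + 1) * (n + 1)) * (1 - X) ^ (d * (n + 3)))
        (by simpa [sub_eq_zero] using e2)
      have h3 := congrArg (eval 0) h0
      simp at h3
      rw [h3, map_zero, zero_mul, eq_comm] at e1
      exact mul_ne_zero (pow_ne_zero _ hy0) (pow_ne_zero _ hq0) e1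
  simpa [genus] using hli.cardinal_le_rank

end IsCyclicCover

/-! ### Reduction to the normal form -/

section Normalization

variable {K : Type} [Field K] [Algebra ℂ K]

lemma _root_.Transcendental.of_mem_adjoin_simple {z u : K} (hu : Transcendental ℂ u)
    (h : u ∈ ℂ⟮z⟯) : Transcendental ℂ z := by
  refine transcendental_of_forall_ne fun a ha => ?_
  have hbot : ℂ⟮z⟯ = ⊥ := by
    rw [ha]
    exact IntermediateField.adjoin_simple_eq_bot_iff.2 (IntermediateField.algebraMap_mem _ a)
  rw [hbot, IntermediateField.mem_bot] at h
  obtain ⟨b, hb⟩ := h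
  exact hu.ne_algebraMap b hb.symm

/-- Normal forms of a cyclic cover `V ^ N = z ^ a ((1 - z) / (1 - μ z)) ^ b`: with `k` inverse to
`a` and `k b = c + m N`, one can reduce to the exponents `N - c` and `c`. -/
lemma exists_isCyclicCover {N a b k l m c : ℕ} {μ : ℂ} {z V : K} (hz : Transcendental ℂ z)
    (htop : IntermediateField.adjoin ℂ {z, V} = ⊤)
    (hV : V ^ N * (1 - algebraMap ℂ K μ * z) ^ b = z ^ a * (1 - z) ^ b)
    (hμ0 : μ ≠ 0) (hμ1 : μ ≠ 1) (hka : k * a = 1 + l * N) (hkb : k * b = c + m * N)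
    (hc0 : 0 < c) (hcN : c < N) :
    (∃ y : K, IsCyclicCover N (N - c) μ z y) ∧
      ∃ y : K, IsCyclicCover N c μ⁻¹ (algebraMap ℂ K μ * z) y := by
  have hz0 : z ≠ 0 := by simpa using hz.ne_algebraMap 0
  have hq0 := hz.one_sub_ne_zero
  have hp0 := hz.one_sub_mul_ne_zero μ
  have hμ : algebraMap ℂ K μ ≠ 0 := by simpa using hμ0
  have hV0 : V ≠ 0 := by
    rintro rfl
    rw [zero_pow (by omega), zero_mul] at hV
    exact mul_ne_zero (pow_ne_zero _ hz0) (pow_ne_zero _ hq0) hV.symm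
  set s := (1 - algebraMap ℂ K μ * z) / (1 - z) with hs
  have hs0 : s ≠ 0 := div_ne_zero hp0 hq0
  have hVs : V ^ N * s ^ b = z ^ a := by
    rw [hs, div_pow, ← mul_div_assoc, hV, mul_div_cancel_right₀ _ (pow_ne_zero _ hq0)]
  set y := V ^ k * s ^ m / z ^ l with hy
  have hyN : y ^ N * s ^ c = z := by
    have h1 := congrArg (· ^ k) hVs
    simp only [mul_pow, ← pow_mul] at h1
    rw [mul_comm b k, mul_comm a k, hkb, hka, mul_comm N k, pow_add, pow_add, pow_one] at h1
    rw [hy, div_pow, mul_pow, ← pow_mul, ← pow_mul, ← pow_mul, div_mul_eq_mul_div,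
      div_eq_iff (pow_ne_zero _ hz0), ← h1]
    ring
  have hmemV : ∀ {M : IntermediateField ℂ K}, z ∈ M → y ∈ M → M = ⊤ := by
    intro M hzM hyM
    have hsM : s ∈ M := div_mem (sub_mem (one_mem _)
      (mul_mem (IntermediateField.algebraMap_mem _ _) hzM)) (sub_mem (one_mem _) hzM)
    have hVk : V ^ k ∈ M := by
      have e : V ^ k = y * z ^ l / s ^ m := by
        rw [hy, div_mul_cancel₀ _ (pow_ne_zero _ hz0), mul_div_cancel_right₀ _ (pow_ne_zero _ hs0)]
      rw [e]
      exact div_mem (mul_mem hyM (pow_mem hzM _)) (pow_mem hsM _)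
    have hVN : V ^ N ∈ M := by
      rw [← eq_div_iff (pow_ne_zero _ hs0)] at hVs
      rw [hVs]
      exact div_mem (pow_mem hzM _) (pow_mem hsM _)
    have hVM : V ∈ M := by
      -- Since ka = 1 + lN, V is recovered from V^k, which comes from y, and V^N, which comes from
      -- z.
      have e : V = (V ^ k) ^ a / (V ^ N) ^ l := by
        rw [← pow_mul, ← pow_mul, hka, mul_comm N l, pow_add, pow_one,
          mul_div_cancel_right₀ _ (pow_ne_zero _ hV0)]
      rw [e]
      exact div_mem (pow_mem hVk _) (pow_mem hVN _)
    rw [eq_top_iff, ← htop, IntermediateField.adjoin_le_iff]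
    rintro f (rfl | rfl)
    · exact hzM
    · exact hVM
  clear_value y s
  constructor
  · refine ⟨y * s, hz, ?_, ?_, hμ0, hμ1, by omega, by omega⟩
    · have hzM : z ∈ IntermediateField.adjoin ℂ {z, y * s} :=
        IntermediateField.subset_adjoin _ _ (by simp)
      have hsM : (1 - algebraMap ℂ K μ * z) / (1 - z) ∈
          IntermediateField.adjoin ℂ {z, y * s} := div_mem (sub_mem (one_mem _)
        (mul_mem (IntermediateField.algebraMap_mem _ _) hzM)) (sub_mem (one_mem _) hzM)
      rw [← hs] at hsM
      refine hmemV hzM ?_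
      have := div_mem (IntermediateField.subset_adjoin ℂ {z, y * s} (Set.mem_insert_of_mem _ rfl)) hsM
      rwa [mul_div_cancel_right₀ _ hs0] at this
    · have e : (y * s) ^ N = z * s ^ (N - c) := by
        obtain ⟨d, rfl⟩ : ∃ d, N = c + d := ⟨N - c, by omega⟩
        rw [add_tsub_cancel_left, mul_pow, pow_add s, ← mul_assoc, hyN]
      rw [e, hs, div_pow, mul_assoc, div_mul_cancel₀ _ (pow_ne_zero _ hq0)]
  -- Rescaling z to μz exchanges the roles of 1-z and 1-μz; y absorbs the factor μ through an N-th
  -- root.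
  · obtain ⟨ν, hν⟩ := IsAlgClosed.exists_pow_nat_eq μ (n := N) (by omega)
    have hν0 : ν ≠ 0 := by
      rintro rfl
      rw [zero_pow (by omega)] at hν
      exact hμ0 hν.symm
    have hν0' : algebraMap ℂ K ν ≠ 0 := by simpa using hν0
    have hz' : Transcendental ℂ (algebraMap ℂ K μ * z) := by
      refine hz.of_mem_adjoin_simple ?_
      have := div_mem (IntermediateField.mem_adjoin_simple_self ℂ (algebraMap ℂ K μ * z))
        (IntermediateField.algebraMap_mem ℂ⟮algebraMap ℂ K μ * z⟯ μ)
      rwa [mul_div_cancel_left₀ _ hμ] at this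
    refine ⟨algebraMap ℂ K ν * y, hz', ?_, ?_, inv_ne_zero hμ0, by simpa using hμ1, hc0, hcN⟩
    · refine hmemV ?_ ?_
      · have := div_mem (IntermediateField.subset_adjoin ℂ
          {algebraMap ℂ K μ * z, algebraMap ℂ K ν * y} (Set.mem_insert _ _))
          (IntermediateField.algebraMap_mem _ μ)
        rwa [mul_div_cancel_left₀ _ hμ] at this
      · have := div_mem (IntermediateField.subset_adjoin ℂ
          {algebraMap ℂ K μ * z, algebraMap ℂ K ν * y} (Set.mem_insert_of_mem _ rfl))
          (IntermediateField.algebraMap_mem _ ν)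
        rwa [mul_div_cancel_left₀ _ hν0'] at this
    · rw [map_inv₀, inv_mul_cancel_left₀ hμ, mul_pow, ← map_pow, hν]
      rw [hs, div_pow, ← mul_div_assoc, div_eq_iff (pow_ne_zero _ hq0)] at hyN
      rw [mul_assoc, hyN, mul_assoc]

end Normalization

/-! ### Translating the conditions on a, b into conditions on c -/

section Arithmetic

/-- Modulo N, c = b/a with a invertible, so b ≡ a, b ≡ -a and 2b ≡ 0 correspond to c ≡ 1, c ≡ -1 and
2c ≡ 0. The bounds turn the congruences into equalities. -/
lemma eq_or_add_eq_or_iff {N a b k l m c : ℕ} (ha : 1 ≤ a) (haN : a ≤ N - 1) (hb : 1 ≤ b)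
    (hbN : b ≤ N - 1) (hka : k * a = 1 + l * N) (hkb : k * b = c + m * N) (hc0 : 0 < c)
    (hcN : c < N) :
    (a = b ∨ a + b = N ∨ ∃ m : ℕ, N = 2 * m ∧ b = m) ↔ (c = 1 ∨ N - c = 1 ∨ 2 * c = N) := by
  have hN : (0 : ℤ) < N := by omega
  have hka' : (k : ℤ) * a = 1 + l * N := by exact_mod_cast hka
  have hkb' : (k : ℤ) * b = c + m * N := by exact_mod_cast hkb
  have haN' : (a : ℤ) + 1 ≤ N := by omega
  have hbN' : (b : ℤ) + 1 ≤ N := by omega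
  have hac : (N : ℤ) ∣ a * c - b := ⟨b * l - a * m, by linear_combination b * hka' - a * hkb'⟩
  constructor
  · rintro (rfl | h | ⟨n, hn, rfl⟩)
    · left
      have : (N : ℤ) ∣ c - 1 := ⟨l - m, by linear_combination hka' - hkb'⟩
      have := Int.eq_zero_of_dvd_of_nonneg_of_lt (by omega) (by omega) this
      omega
    · right; left
      have h' : (a : ℤ) + b = N := by exact_mod_cast h
      have : (N : ℤ) ∣ N - 1 - c := ⟨1 - k + m + l, by linear_combination hka' + hkb' - k * h'⟩
      have := Int.eq_zero_of_dvd_of_nonneg_of_lt (by omega) (by omega) this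
      omega
    · right; right
      have hn' : (N : ℤ) = 2 * b := by exact_mod_cast hn
      have h1 : (N : ℤ) ∣ 2 * c := ⟨k - 2 * m, by linear_combination -k * hn' - 2 * hkb'⟩
      obtain ⟨e, he⟩ := h1
      have : 0 < e := by by_contra! h; nlinarith
      have : e < 2 := by by_contra! h; nlinarith
      have : e = 1 := by omega
      rw [this] at he
      omega
  · rintro (rfl | h | h)
    · left
      have h1 : (N : ℤ) ∣ a - b := by simpa using hac
      rcases le_total a b with h | h
      · have := Int.eq_zero_of_dvd_of_nonneg_of_lt (show (0 : ℤ) ≤ b - a by omega)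
          (show (b : ℤ) - a < N by omega) (by rw [← dvd_neg]; simpa using h1)
        omega
      · have := Int.eq_zero_of_dvd_of_nonneg_of_lt (by omega) (by omega) h1
        omega
    · right; left
      have hc : (c : ℤ) = N - 1 := by omega
      have h1 : (N : ℤ) ∣ a + b := by
        obtain ⟨e, he⟩ := hac
        exact ⟨a - e, by linear_combination a * hc - he⟩
      obtain ⟨e, he⟩ := h1
      have : 0 < e := by by_contra! h; nlinarith
      have : e < 2 := by by_contra! h; nlinarith
      have : e = 1 := by omega
      rw [this] at he
      omega
    · right; right
      have hc : (2 : ℤ) * c = N := by exact_mod_cast h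
      have h1 : (N : ℤ) ∣ 2 * b := by
        obtain ⟨e, he⟩ := hac
        exact ⟨a - 2 * e, by linear_combination a * hc - 2 * he⟩
      obtain ⟨e, he⟩ := h1
      have : 0 < e := by by_contra! h; nlinarith
      have : e < 2 := by by_contra! h; nlinarith
      have : e = 1 := by omega
      rw [this] at he
      exact ⟨b, by omega, rfl⟩

lemma exists_inverse_mod {N a b : ℕ} (hb : 1 ≤ b) (hbN : b ≤ N - 1) (h : Nat.gcd N a = 1) :
    ∃ k l m c : ℕ, k * a = 1 + l * N ∧ k * b = c + m * N ∧ 0 < c ∧ c < N := by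
  obtain ⟨k, -, hk⟩ := Nat.exists_mul_mod_eq_one_of_coprime (Nat.coprime_comm.1 h) (by omega)
  have hk' : k * a = 1 + k * a / N * N := by
    have := Nat.mod_add_div (k * a) N
    rw [mul_comm N, mul_comm k a, hk] at this
    rw [mul_comm k a]
    exact this.symm
  refine ⟨k, k * a / N, k * b / N, k * b % N, hk', ?_, ?_, Nat.mod_lt _ (by omega)⟩
  · rw [mul_comm _ N, Nat.mod_add_div]
  · rw [Nat.pos_iff_ne_zero, Ne, ← Nat.dvd_iff_mod_eq_zero]
    intro hdvd
    have h1 : N ∣ b * (k * a) := by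
      rw [← mul_assoc, mul_comm b k]
      exact hdvd.mul_right a
    rw [hk', mul_add, mul_one, ← mul_assoc] at h1
    have h2 := (Nat.dvd_add_left (Nat.dvd_mul_left N _)).1 h1
    have := Nat.le_of_dvd (by omega) h2
    omega

end Arithmetic

/-! ### Coordinates on the quotient curve -/

namespace QuotientCurve

variable (Q : QuotientCurve)

lemma of_injective : Function.Injective (AdjoinRoot.of Q.polynomial) := by
  refine AdjoinRoot.of.injective_of_degree_ne_zero ?_
  rw [polynomial, degree_X_pow_sub_C Q.N_pos]
  exact_mod_cast Q.N_pos.ne'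

/-- The coordinate function `u`. -/
def u : Q.FunctionField := algebraMap Q.CoordinateRing _ (AdjoinRoot.of Q.polynomial X)

/-- The coordinate function `v`. -/
def v : Q.FunctionField := algebraMap Q.CoordinateRing _ (AdjoinRoot.root Q.polynomial)

lemma aeval_u (f : ℂ[X]) :
    aeval Q.u f = algebraMap Q.CoordinateRing Q.FunctionField (AdjoinRoot.of Q.polynomial f) := by
  induction f using Polynomial.induction_on' with
  | add f g hf hg => rw [map_add, map_add, map_add, hf, hg]
  | monomial n c =>
    rw [aeval_monomial, ← C_mul_X_pow_eq_monomial, map_mul, map_mul, map_pow, map_pow]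
    rfl

lemma transcendental_u : Transcendental ℂ Q.u := by
  rw [transcendental_iff]
  intro f hf
  rw [aeval_u] at hf
  have h1 : AdjoinRoot.of Q.polynomial f = 0 :=
    IsFractionRing.injective Q.CoordinateRing Q.FunctionField (by rw [hf, map_zero])
  exact Q.of_injective (by rw [h1, map_zero])

lemma v_pow : Q.v ^ Q.N = (-Q.u) ^ Q.a * (1 - Q.u) ^ (Q.N - Q.a) *
    (1 - algebraMap ℂ Q.FunctionField Q.lam * Q.u) ^ (Q.N - Q.b) := by
  have h : AdjoinRoot.root Q.polynomial ^ Q.N = AdjoinRoot.of Q.polynomial Q.rhs := by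
    have h : AdjoinRoot.mk Q.polynomial (X ^ Q.N - C Q.rhs) = 0 := AdjoinRoot.mk_self
    rwa [map_sub, map_pow, AdjoinRoot.mk_X, AdjoinRoot.mk_C, sub_eq_zero] at h
  rw [v, ← map_pow, h, ← aeval_u]
  simp [rhs]

lemma adjoin_u_v : IntermediateField.adjoin ℂ {Q.u, Q.v} = ⊤ := by
  have hu : Q.u ∈ IntermediateField.adjoin ℂ {Q.u, Q.v} :=
    IntermediateField.subset_adjoin _ _ (by simp)
  have hv : Q.v ∈ IntermediateField.adjoin ℂ {Q.u, Q.v} :=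
    IntermediateField.subset_adjoin _ _ (by simp)
  have haeval : ∀ f : ℂ[X], aeval Q.u f ∈ IntermediateField.adjoin ℂ {Q.u, Q.v} := fun f =>
    Algebra.adjoin_le (S := (IntermediateField.adjoin ℂ {Q.u, Q.v}).toSubalgebra)
      (Set.singleton_subset_iff.2 hu) (aeval_mem_adjoin_singleton ℂ Q.u)
  have hmem : ∀ r : Q.CoordinateRing, algebraMap Q.CoordinateRing Q.FunctionField r ∈
      IntermediateField.adjoin ℂ {Q.u, Q.v} := by
    intro r
    obtain ⟨p, rfl⟩ := AdjoinRoot.mk_surjective r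
    induction p using Polynomial.induction_on' with
    | add p q hp hq => rw [map_add, map_add]; exact add_mem hp hq
    | monomial n f =>
      rw [← C_mul_X_pow_eq_monomial, map_mul, map_mul, map_pow, map_pow, AdjoinRoot.mk_X,
        AdjoinRoot.mk_C, ← aeval_u]
      exact mul_mem (haeval f) (pow_mem hv n)
  refine eq_top_iff.2 fun f _ => ?_
  obtain ⟨r, t, -, rfl⟩ := IsFractionRing.div_surjective (A := Q.CoordinateRing) f
  exact div_mem (hmem r) (hmem t)

/-- The curve in the coordinates `z = -u / (1 - u)` and `V = v / ((1 - u) (1 - λ u))`. -/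
lemma exists_coordinates : ∃ z V : Q.FunctionField, Transcendental ℂ z ∧
    IntermediateField.adjoin ℂ {z, V} = ⊤ ∧
    V ^ Q.N * (1 - algebraMap ℂ _ (1 - Q.lam) * z) ^ Q.b = z ^ Q.a * (1 - z) ^ Q.b := by
  have hu := Q.transcendental_u
  have h1 := hu.one_sub_ne_zero
  have h2 := hu.one_sub_mul_ne_zero Q.lam
  have hz : ∀ M : IntermediateField ℂ Q.FunctionField, -Q.u / (1 - Q.u) ∈ M → Q.u ∈ M := by
    intro M hM
    -- The Möbius map u ↦ -u/(1-u) is an involution, so u = z/(z-1).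
    have e : Q.u = (-Q.u / (1 - Q.u)) / (-Q.u / (1 - Q.u) - 1) := by
      have : -Q.u / (1 - Q.u) - 1 = -1 / (1 - Q.u) := by field_simp; ring
      rw [this]
      field_simp
    rw [e]
    exact div_mem hM (sub_mem hM (one_mem _))
  refine ⟨-Q.u / (1 - Q.u), Q.v / ((1 - Q.u) * (1 - algebraMap ℂ _ Q.lam * Q.u)),
    hu.of_mem_adjoin_simple (hz _ (IntermediateField.mem_adjoin_simple_self _ _)), ?_, ?_⟩
  · generalize hM : IntermediateField.adjoin ℂ {-Q.u / (1 - Q.u), Q.v / ((1 - Q.u) *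
      (1 - algebraMap ℂ _ Q.lam * Q.u))} = M
    have huM : Q.u ∈ M := hz M (hM ▸ IntermediateField.subset_adjoin _ _ (by simp))
    have hVM : Q.v / ((1 - Q.u) * (1 - algebraMap ℂ _ Q.lam * Q.u)) ∈ M :=
      hM ▸ IntermediateField.subset_adjoin _ _ (by simp)
    rw [eq_top_iff, ← Q.adjoin_u_v, IntermediateField.adjoin_le_iff]
    rintro f (rfl | rfl)
    · exact huM
    · have := mul_mem hVM (mul_mem (sub_mem (one_mem _) huM) (sub_mem (one_mem _)
        (mul_mem (IntermediateField.algebraMap_mem _ Q.lam) huM)))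
      rwa [div_mul_cancel₀ _ (mul_ne_zero h1 h2)] at this
  · have e1 : 1 - -Q.u / (1 - Q.u) = 1 / (1 - Q.u) := by field_simp; ring
    have e2 : 1 - algebraMap ℂ _ (1 - Q.lam) * (-Q.u / (1 - Q.u)) =
        (1 - algebraMap ℂ _ Q.lam * Q.u) / (1 - Q.u) := by
      rw [map_sub, map_one]; field_simp; ring
    have haN := Q.a_le
    have hbN := Q.b_le
    have hN := Q.N_pos
    rw [e1, e2, div_pow, v_pow, div_pow, div_pow, div_pow, one_pow, mul_pow]
    generalize (1 - algebraMap ℂ Q.FunctionField Q.lam * Q.u) = s at *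
    obtain ⟨d, hd⟩ : ∃ d, Q.N = Q.a + d := ⟨Q.N - Q.a, by omega⟩
    obtain ⟨e, he⟩ : ∃ e, Q.N = Q.b + e := ⟨Q.N - Q.b, by omega⟩
    have hs : s ^ Q.N = s ^ Q.b * s ^ (Q.N - Q.b) := by rw [← pow_add]; congr 1; omega
    have hq : (1 - Q.u) ^ Q.N = (1 - Q.u) ^ Q.a * (1 - Q.u) ^ (Q.N - Q.a) := by
      rw [← pow_add]; congr 1; omega
    rw [hs, hq]
    field_simp

end QuotientCurve

end HypergeometricQuotient
end

theorem proposition3p2 (N a b : ℕ) (ha : 1 ≤ a) (haN : a ≤ N - 1) (hb : 1 ≤ b) (hbN : b ≤ N - 1)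
    (hgcd : Nat.gcd N a = 1) (lam : ℂ) (h0 : lam ≠ 0) (h1 : lam ≠ 1) :
    let K := (HypergeometricQuotient.QuotientCurve.mk
      N a b lam ha haN hb hbN hgcd h0 h1).FunctionField
    (HypergeometricQuotient.HasDegreeTwoMapToP1 K ↔
      (a = b ∨ a + b = N ∨ ∃ m : ℕ, N = 2 * m ∧ b = m)) ∧
    (3 ≤ N → (HypergeometricQuotient.IsHyperelliptic K ↔
      (a = b ∨ a + b = N ∨ ∃ m : ℕ, N = 2 * m ∧ b = m))) := by
  intro K
  obtain ⟨z, V, hz, htop, hV⟩ := (HypergeometricQuotient.QuotientCurve.mk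
    N a b lam ha haN hb hbN hgcd h0 h1).exists_coordinates
  obtain ⟨k, l, m, c, hka, hkb, hc0, hcN⟩ :=
    HypergeometricQuotient.exists_inverse_mod hb hbN hgcd
  obtain ⟨⟨y, hy⟩, y', hy'⟩ :
      (∃ y : K, HypergeometricQuotient.IsCyclicCover N (N - c) (1 - lam) z y) ∧
        ∃ y : K, HypergeometricQuotient.IsCyclicCover N c (1 - lam)⁻¹
          (algebraMap ℂ K (1 - lam) * z) y := HypergeometricQuotient.exists_isCyclicCover hz htop hV
    (sub_ne_zero.2 h1.symm) (fun h => h0 (by linear_combination -h)) hka hkb hc0 hcN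
  rw [HypergeometricQuotient.eq_or_add_eq_or_iff ha haN hb hbN hka hkb hc0 hcN]
  have key : HypergeometricQuotient.HasDegreeTwoMapToP1 K ↔ c = 1 ∨ N - c = 1 ∨ 2 * c = N := by
    -- One of the exponents c and N-c is at most N/2; the matching normal form is used.
    rcases le_total (2 * c) N with h | h
    · refine (hy'.hasDegreeTwoMapToP1_iff h).trans ?_
      omega
    · refine (hy.hasDegreeTwoMapToP1_iff (by omega)).trans ?_
      omega
  refine ⟨key, fun hN => ⟨fun h => key.1 h.2, fun h => ⟨?_, key.2 h⟩⟩⟩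
  exact hy'.two_le_genus hN (key.2 h)
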